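/- Let $n\ge 2$, let $Q=[0,1]^n$, and let $\varphi:[0,\infty)\to[0,\infty)$ be (strictly) increasing, concave and continuous with $\varphi(0)=0$ and $\int_0^1\frac{ds}{\varphi(s)}<\infty$. Then there exist a homeomorphism $\Phi$ of $Q$ onto itself, a set $A$ contained in the interior of $Q$, and a constant $C=C(n,\varphi)$ depending only on $n$ and $\varphi$, such that: 1. $\Phi$ is approximately differentiable at almost every point of $Q$ and has the Lusin property (N): $|\Phi(N)|=0$ for every $N\subset Q$ with $|N|=0$; 2. $\Phi(x)=x$ for all $x\in\partial Q$; 3. $A$ is a Cantor set, i.e. it is nonempty, compact, perfect and totally disconnected, and its Lebesgue measure is positive, $|A|>0$; 4. $\Phi(x_1,\ldots,x_{n-1},x_n)=(x_1,\ldots,x_{n-1},1-x_n)$ for all $x\in A$, $\Phi(A)=A$, and $\Phi$ is a $C^\infty$-diffeomorphism outside $A$, i.e. $\Phi$ is $C^\infty$ on $Q\setminus A$ and $\Phi^{-1}$ is $C^\infty$ on $\Phi(Q\setminus A)$; 5. at almost every $x\in A$ the approximate derivative is $\operatorname{ap}D\Phi(x)=\operatorname{diag}(1,\ldots,1,-1)$;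 6. for all $x,y\in Q$, $\;|\Phi(x)-\Phi(y)|+|\Phi^{-1}(x)-\Phi^{-1}(y)|\le C\,\varphi(|x-y|)$. Here $|\cdot|$ is the Euclidean norm on vectors and Lebesgue measure on sets, and $\Phi$ is approximately differentiable at $x\in Q$ with approximate derivative the linear map $L=\operatorname{ap}D\Phi(x)$ if there is a measurable set $E_x\subset Q$ having $x$ as a Lebesgue density point such that $\frac{|\Phi(y)-\Phi(x)-L(y-x)|}{|y-x|}\to 0$ as $y\to x$, $y\in E_x$. -/

import Mathlib

open Set Filter Topology MeasureTheory
open scoped ContDiff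

noncomputable section

namespace CubeFlip

/-- The space `ℝⁿ` with its Euclidean norm and Lebesgue measure. -/
abbrev Space (n : ℕ) : Type := EuclideanSpace ℝ (Fin n)

/-- The closed unit cube `Q = [0,1]ⁿ`. -/
def cube (n : ℕ) : Set (Space n) := {x | ∀ i, x i ∈ Icc (0 : ℝ) 1}

/-- `Φ` is a homeomorphism of `S` onto itself, with inverse `Φ.symm`. The values of the two
underlying functions outside `S` play no role. -/
structure IsSelfHomeo {n : ℕ} (Φ : PartialEquiv (Space n) (Space n)) (S : Set (Space n)) :
    Prop where
  source_eq : Φ.source = S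
  target_eq : Φ.target = S
  continuousOn_toFun : ContinuousOn Φ S
  continuousOn_symm : ContinuousOn Φ.symm S

/-- `x` is a (Lebesgue) density point of `T`. -/
def IsDensityPoint {n : ℕ} (T : Set (Space n)) (x : Space n) : Prop :=
  Tendsto (fun r : ℝ => volume (T ∩ Metric.closedBall x r) / volume (Metric.closedBall x r))
    (𝓝[>] 0) (𝓝 1)

/-- The map `f`, considered on the set `S`, is approximately differentiable at `x` with approximate
derivative `L`: there is a measurable `T ⊆ S` with density point `x` such that
`(f y - f x - L (y - x)) / |y - x| → 0` as `y → x` within `T`. -/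
def HasApproxFDerivOnAt {n : ℕ} (f : Space n → Space n) (L : Space n →L[ℝ] Space n)
    (S : Set (Space n)) (x : Space n) : Prop :=
  ∃ T : Set (Space n), T ⊆ S ∧ MeasurableSet T ∧ IsDensityPoint T x ∧ HasFDerivWithinAt f L T x

/-- Lusin's property (N) of the map `f` on the set `S`. -/
def LusinN {n : ℕ} (f : Space n → Space n) (S : Set (Space n)) : Prop :=
  ∀ N : Set (Space n), N ⊆ S → volume N = 0 → volume (f '' N) = 0

/-- A Cantor set: nonempty, compact, perfect and totally disconnected. -/
structure IsCantorSet {n : ℕ} (A : Set (Space n)) : Prop where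
  nonempty : A.Nonempty
  isCompact : IsCompact A
  perfect : Perfect A
  isTotallyDisconnected : IsTotallyDisconnected A

/-- The reflection `(x₁, …, xₙ₋₁, xₙ) ↦ (x₁, …, xₙ₋₁, 1 - xₙ)`. -/
def reflectLast {n : ℕ} (x : Space n) : Space n :=
  WithLp.toLp 2 fun i : Fin n => if (i : ℕ) + 1 = n then 1 - x i else x i

/-- The diagonal matrix `diag(1, …, 1, -1)`. -/
def reflectionMatrix (n : ℕ) : Matrix (Fin n) (Fin n) ℝ :=
  Matrix.diagonal fun i : Fin n => if (i : ℕ) + 1 = n then -1 else 1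

/-- The linear map of `ℝⁿ` with matrix `diag(1, …, 1, -1)`. -/
def reflectionCLM (n : ℕ) : Space n →L[ℝ] Space n :=
  Matrix.toEuclideanCLM (n := Fin n) (𝕜 := ℝ) (reflectionMatrix n)

/-- `Φ` restricts to a `C^∞` diffeomorphism of the set `U` onto its image `Φ '' U`: `Φ` is smooth
on `U` and its inverse is smooth on `Φ '' U`. -/
def IsSmoothDiffeoOn {n : ℕ} (Φ : PartialEquiv (Space n) (Space n)) (U : Set (Space n)) : Prop :=
  U ⊆ Φ.source ∧ ContDiffOn ℝ ∞ Φ U ∧ ContDiffOn ℝ ∞ Φ.symm (Φ '' U)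

end CubeFlip

end

/-!
The map is the limit of an infinite composition of *swaps*. A swap of relative gap `δ` is a
diffeomorphism of the unit cube, the identity off the cube, which carries each of `2ⁿ` cubes of side
`(1 - δ) / 2`, concentric with the dyadic subcubes, by a translation to its mirror image in
the hyperplane `xₙ = 1 / 2`. Repeating this inside the small cubes, with gaps `δ₀, δ₁, …`, gives
maps `iter r G k 0` which are eventually constant off the Cantor set `A = limitSet n r 0` of the
points that lie in small cubes of every generation. On `A` they converge to the reflection, since at
every scale the upper and the lower half are exchanged.

A swap can be chosen with Lipschitz constant of order `1 / δ`, and so can its inverse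
(`exists_isSwap`): the gaps are stretched to a fixed size by an expanding product map, which is a
translation on each of the small cubes and has Lipschitz constant of order `1 / δ`; the
enlarged picture leaves room for a fixed diffeomorphism exchanging the upper and the lower cubes;
and the inverse of the stretching is `1`-Lipschitz. The fixed diffeomorphism is a composition of
three twists (`exists_exchange`), which needs a second coordinate to rotate into.

A swap is a translation on the small cubes, where all later swaps act, so that the derivative of an
iterate is at each point the derivative of just one swap (`norm_fderiv_iter_le`), and the map of
generation `k + 1` has Lipschitz constant of order `1 / δ k`, rather than a product of such numbers.
Its distance from the limit is of order `2 ^ (-k)`. The two estimates give the modulus of continuity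
`φ` (`norm_limitMap_sub_le`) when `δ k` is proportional to `2 ^ k * d k`, with
`φ (d k) = φ 1 / 2 ^ k`.
The set `A` has positive measure when `∑ δ k` is finite, which follows from the integrability of
`1 / φ` (`exists_gaps`).

Off `A` the limit is locally a smooth map, and on `A` it is a reflection: this gives
Lusin's property, and approximate differentiability at interior points off `A` and at the density
points of `A`. All constructions are symmetric in the swaps and their inverses, so that every
statement about the limit holds for its inverse as well.
-/

namespace CubeFlip

/-! ### Smooth stretching of the line -/

theorem exists_contDiff_inverse {f : ℝ → ℝ} (hf : ContDiff ℝ ∞ f)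
    (hm : Monotone fun t => f t - t) :
    ∃ g : ℝ → ℝ, ContDiff ℝ ∞ g ∧ Function.LeftInverse g f ∧ Function.RightInverse g f ∧
      ∀ a b, |g a - g b| ≤ |a - b| := by
  have hlt : StrictMono f := fun a b hab => by
    have := hm hab.le
    simp only at this
    linarith
  have hsurj : Function.Surjective f := by
    refine hf.continuous.surjective ?_ ?_
    · refine tendsto_atTop_mono' atTop ?_ (tendsto_atTop_add_const_right atTop (f 0) tendsto_id)
      filter_upwards [eventually_ge_atTop 0] with t ht
      have := hm ht
      simp only [id] at this ⊢
      linarith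
    · refine tendsto_atBot_mono' atBot ?_ (tendsto_atBot_add_const_right atBot (f 0) tendsto_id)
      filter_upwards [eventually_le_atBot 0] with t ht
      have := hm ht
      simp only [id] at this ⊢
      linarith
  let e : ℝ ≃ₜ ℝ := (StrictMono.orderIsoOfSurjective f hlt hsurj).toHomeomorph
  have he : ∀ t, e t = f t := fun t => rfl
  have hdiff : ∀ t, HasDerivAt f (deriv f t) t := fun t =>
    (hf.differentiable (by simp) t).hasDerivAt
  have hpos : ∀ t, deriv f t ≠ 0 := fun t => by
    have h1 := ((hdiff t).sub (hasDerivAt_id t)).deriv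
    have h2 : 0 ≤ deriv (f - id) t := Monotone.deriv_nonneg hm
    rw [h1] at h2
    linarith
  have hright : Function.RightInverse e.symm f := fun t => by rw [← he, e.apply_symm_apply]
  refine ⟨e.symm, ?_, fun t => by rw [← he, e.symm_apply_apply], hright, ?_⟩
  · exact e.contDiff_symm_deriv hpos (fun t => hdiff t) hf
  · have key : ∀ a b, a ≤ b → |e.symm a - e.symm b| ≤ |a - b| := fun a b hab => by
      have h0 : e.symm a ≤ e.symm b := by
        by_contra! h
        have := hlt h
        rw [hright, hright] at this
        linarith
      have := hm h0
      simp only [hright a, hright b] at this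
      rw [abs_of_nonpos (by linarith), abs_of_nonpos (by linarith)]
      linarith
    intro a b
    rcases le_total a b with h | h
    · exact key a b h
    · rw [abs_sub_comm, abs_sub_comm a]
      exact key b a h

theorem exists_abs_smoothTransition_sub_le :
    ∃ h : ℝ, 0 ≤ h ∧ ∀ a b, |Real.smoothTransition a - Real.smoothTransition b| ≤ h * |a - b| := by
  have hc : ContDiff ℝ 1 Real.smoothTransition := Real.smoothTransition.contDiff (n := 1)
  obtain ⟨C, hC⟩ := (isCompact_Icc (a := (0 : ℝ)) (b := 1)).exists_bound_of_continuousOn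
    (hc.continuous_deriv le_rfl).continuousOn
  have hb : ∀ t, ‖deriv Real.smoothTransition t‖ ≤ max C 0 := fun t => by
    by_cases ht : t ∈ Icc (0 : ℝ) 1
    · exact (hC t ht).trans (le_max_left _ _)
    · have : deriv Real.smoothTransition t = 0 := by
        rw [mem_Icc, not_and_or, not_le, not_le] at ht
        rcases ht with ht | ht
        · have : Real.smoothTransition =ᶠ[𝓝 t] fun _ => 0 := by
            filter_upwards [gt_mem_nhds ht] with s hs
            exact Real.smoothTransition.zero_of_nonpos hs.le
          rw [this.deriv_eq, deriv_const]
        · have : Real.smoothTransition =ᶠ[𝓝 t] fun _ => 1 := by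
            filter_upwards [lt_mem_nhds ht] with s hs
            exact Real.smoothTransition.one_of_one_le hs.le
          rw [this.deriv_eq, deriv_const]
      rw [this, norm_zero]
      exact le_max_right _ _
  refine ⟨max C 0, le_max_right _ _, fun a b => ?_⟩
  have := Convex.norm_image_sub_le_of_norm_deriv_le (f := Real.smoothTransition) (s := univ)
    (fun x _ => (hc.differentiable (by simp)).differentiableAt) (fun x _ => hb x) convex_univ
    (mem_univ b) (mem_univ a)
  simpa [Real.norm_eq_abs] using this

/-- The increasing function which shifts `1 / 2` to the origin, stretches the middle gap
`|t - 1 / 2| ≤ δ / 8` by a total of `K₁`, stretches each of the marginal gaps `[0, δ / 8]` and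
`[1 - δ / 8, 1]` by `K₀`, and is a translation on each of the remaining intervals. -/
noncomputable def stretch (K₀ K₁ δ t : ℝ) : ℝ :=
  t - 1 / 2 + K₀ * (Real.smoothTransition (8 * (t - 1) / δ + 1) -
    Real.smoothTransition (1 - 8 * t / δ)) +
    K₁ * (Real.smoothTransition (4 * (t - 1 / 2) / δ + 1 / 2) - 1 / 2)

theorem contDiff_stretch (K₀ K₁ δ : ℝ) : ContDiff ℝ ∞ (stretch K₀ K₁ δ) := by
  have h : ContDiff ℝ ∞ Real.smoothTransition := Real.smoothTransition.contDiff (n := ⊤)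
  have h1 : ContDiff ℝ ∞ fun t : ℝ => Real.smoothTransition (8 * (t - 1) / δ + 1) :=
    h.comp (by fun_prop)
  have h2 : ContDiff ℝ ∞ fun t : ℝ => Real.smoothTransition (1 - 8 * t / δ) :=
    h.comp (by fun_prop)
  have h3 : ContDiff ℝ ∞ fun t : ℝ => Real.smoothTransition (4 * (t - 1 / 2) / δ + 1 / 2) :=
    h.comp (by fun_prop)
  unfold stretch
  fun_prop

theorem monotone_stretch_sub {K₀ K₁ δ : ℝ} (h₀ : 0 ≤ K₀) (h₁ : 0 ≤ K₁) (hδ : 0 < δ) :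
    Monotone fun t => stretch K₀ K₁ δ t - t := by
  intro s t hst
  have h1 : Real.smoothTransition (8 * (s - 1) / δ + 1) ≤
      Real.smoothTransition (8 * (t - 1) / δ + 1) :=
    Real.smoothTransition.monotone (by gcongr)
  have h2 : Real.smoothTransition (1 - 8 * t / δ) ≤ Real.smoothTransition (1 - 8 * s / δ) :=
    Real.smoothTransition.monotone (by gcongr)
  have h3 : Real.smoothTransition (4 * (s - 1 / 2) / δ + 1 / 2) ≤
      Real.smoothTransition (4 * (t - 1 / 2) / δ + 1 / 2) :=
    Real.smoothTransition.monotone (by gcongr)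
  simp only [stretch]
  nlinarith [mul_le_mul_of_nonneg_left h1 h₀, mul_le_mul_of_nonneg_left h2 h₀,
    mul_le_mul_of_nonneg_left h3 h₁]

theorem exists_abs_stretch_sub_le {K₀ K₁ : ℝ} (h₀ : 0 ≤ K₀) (h₁ : 0 ≤ K₁) :
    ∃ M : ℝ, 0 ≤ M ∧ ∀ δ, 0 < δ → δ ≤ 1 → ∀ s t,
      |stretch K₀ K₁ δ s - stretch K₀ K₁ δ t| ≤ M / δ * |s - t| := by
  obtain ⟨h, hh, hH⟩ := exists_abs_smoothTransition_sub_le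
  refine ⟨1 + 16 * K₀ * h + 4 * K₁ * h, by positivity, fun δ hδ hδ1 s t => ?_⟩
  have e1 := hH (8 * (s - 1) / δ + 1) (8 * (t - 1) / δ + 1)
  have e2 := hH (1 - 8 * s / δ) (1 - 8 * t / δ)
  have e3 := hH (4 * (s - 1 / 2) / δ + 1 / 2) (4 * (t - 1 / 2) / δ + 1 / 2)
  rw [show 8 * (s - 1) / δ + 1 - (8 * (t - 1) / δ + 1) = 8 / δ * (s - t) by ring, abs_mul,
    abs_of_pos (a := 8 / δ) (by positivity)] at e1
  rw [show 1 - 8 * s / δ - (1 - 8 * t / δ) = -(8 / δ * (s - t)) by ring, abs_neg, abs_mul,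
    abs_of_pos (a := 8 / δ) (by positivity)] at e2
  rw [show 4 * (s - 1 / 2) / δ + 1 / 2 - (4 * (t - 1 / 2) / δ + 1 / 2) = 4 / δ * (s - t) by ring,
    abs_mul, abs_of_pos (a := 4 / δ) (by positivity)] at e3
  set a₁ := Real.smoothTransition (8 * (s - 1) / δ + 1)
  set b₁ := Real.smoothTransition (8 * (t - 1) / δ + 1)
  set a₂ := Real.smoothTransition (1 - 8 * s / δ)
  set b₂ := Real.smoothTransition (1 - 8 * t / δ)
  set a₃ := Real.smoothTransition (4 * (s - 1 / 2) / δ + 1 / 2)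
  set b₃ := Real.smoothTransition (4 * (t - 1 / 2) / δ + 1 / 2)
  have e0 : |s - t| ≤ 1 / δ * |s - t| :=
    le_mul_of_one_le_left (abs_nonneg _) ((one_le_div hδ).2 hδ1)
  calc |stretch K₀ K₁ δ s - stretch K₀ K₁ δ t|
      = |(s - t) + (K₀ * (a₁ - b₁) + (-(K₀ * (a₂ - b₂)) + K₁ * (a₃ - b₃)))| := by
        simp only [stretch]; congr 1; ring
    _ ≤ |s - t| + (K₀ * |a₁ - b₁| + (K₀ * |a₂ - b₂| + K₁ * |a₃ - b₃|)) := by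
        refine (abs_add_le _ _).trans (add_le_add le_rfl ?_)
        refine (abs_add_le _ _).trans (add_le_add (by rw [abs_mul, abs_of_nonneg h₀]) ?_)
        refine (abs_add_le _ _).trans (add_le_add ?_ (by rw [abs_mul, abs_of_nonneg h₁]))
        rw [abs_neg, abs_mul, abs_of_nonneg h₀]
    _ ≤ 1 / δ * |s - t| + (K₀ * (h * (8 / δ * |s - t|)) + (K₀ * (h * (8 / δ * |s - t|)) +
          K₁ * (h * (4 / δ * |s - t|)))) := by gcongr
    _ = _ := by ring

theorem stretch_of_mem_right {K₀ K₁ δ t : ℝ} (hδ : 0 < δ) (h : 1 / 2 + δ / 8 ≤ t)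
    (h' : t ≤ 1 - δ / 8) : stretch K₀ K₁ δ t = t - 1 / 2 + K₁ / 2 := by
  rw [stretch, Real.smoothTransition.zero_of_nonpos, Real.smoothTransition.zero_of_nonpos,
    Real.smoothTransition.one_of_one_le]
  · ring
  · rw [← sub_le_iff_le_add, le_div_iff₀ hδ]; linarith
  · rw [sub_nonpos, one_le_div hδ]; linarith
  · rw [← le_sub_iff_add_le, div_le_iff₀ hδ]; linarith

theorem stretch_of_mem_left {K₀ K₁ δ t : ℝ} (hδ : 0 < δ) (h : δ / 8 ≤ t)
    (h' : t ≤ 1 / 2 - δ / 8) : stretch K₀ K₁ δ t = t - 1 / 2 - K₁ / 2 := by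
  rw [stretch, Real.smoothTransition.zero_of_nonpos, Real.smoothTransition.zero_of_nonpos,
    Real.smoothTransition.zero_of_nonpos]
  · ring
  · rw [← le_sub_iff_add_le, div_le_iff₀ hδ]; linarith
  · rw [sub_nonpos, one_le_div hδ]; linarith
  · rw [← le_sub_iff_add_le, div_le_iff₀ hδ]; linarith

theorem le_abs_stretch {K₀ K₁ δ t : ℝ} (h₁ : 0 ≤ K₁) (hδ : 0 < δ) (hδ1 : δ ≤ 1)
    (ht : t ∉ Icc (0 : ℝ) 1) : K₀ ≤ |stretch K₀ K₁ δ t| := by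
  rw [mem_Icc, not_and_or, not_le, not_le] at ht
  rcases ht with ht | ht
  · rw [stretch, Real.smoothTransition.one_of_one_le (x := 1 - 8 * t / δ),
      Real.smoothTransition.zero_of_nonpos, Real.smoothTransition.zero_of_nonpos]
    · exact le_trans (by linarith) (neg_le_abs _)
    · rw [← le_sub_iff_add_le, div_le_iff₀ hδ]; linarith
    · rw [← le_sub_iff_add_le, div_le_iff₀ hδ]; linarith
    · rw [le_sub_comm, div_le_iff₀ hδ]; linarith
  · rw [stretch, Real.smoothTransition.one_of_one_le (x := 8 * (t - 1) / δ + 1),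
      Real.smoothTransition.zero_of_nonpos, Real.smoothTransition.one_of_one_le]
    · exact le_trans (by linarith) (le_abs_self _)
    · rw [← sub_le_iff_le_add, le_div_iff₀ hδ]; linarith
    · rw [sub_nonpos, one_le_div hδ]; linarith
    · rw [← sub_le_iff_le_add, le_div_iff₀ hδ]; linarith

/-- The map of `ℝⁿ` acting by `s i` on the `i`-th coordinate. -/
noncomputable def coordMap {n : ℕ} (s : Fin n → ℝ → ℝ) (x : Space n) : Space n :=
  WithLp.toLp 2 fun i => s i (x i)

theorem contDiff_coordMap {n : ℕ} {s : Fin n → ℝ → ℝ} (hs : ∀ i, ContDiff ℝ ∞ (s i)) :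
    ContDiff ℝ ∞ (coordMap s) := by
  rw [contDiff_euclidean]
  intro i
  exact (hs i).comp (contDiff_euclidean.1 contDiff_id i)

theorem norm_coordMap_sub_le {n : ℕ} {s : Fin n → ℝ → ℝ} {M : ℝ} (hM : 0 ≤ M)
    (hs : ∀ i a b, |s i a - s i b| ≤ M * |a - b|) (x y : Space n) :
    ‖coordMap s x - coordMap s y‖ ≤ M * ‖x - y‖ := by
  rw [EuclideanSpace.norm_eq, EuclideanSpace.norm_eq]
  rw [← Real.sqrt_sq hM, ← Real.sqrt_mul (sq_nonneg M), Finset.mul_sum]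
  refine Real.sqrt_le_sqrt (Finset.sum_le_sum fun i _ => ?_)
  rw [← mul_pow]
  exact pow_le_pow_left₀ (norm_nonneg _) (hs i (x i) (y i)) 2

/-! ### Twists, and the exchange of two balls -/

section Twist
open Real
open scoped InnerProductSpace
variable {E : Type*} [NormedAddCommGroup E] [InnerProductSpace ℝ E]

/-- For orthonormal `a`, `b`: the rotation by the angle `t` in the plane spanned by `a` and `b`,
extended by the identity on the orthogonal complement of that plane. -/
noncomputable def planeRotation (a b : E) (t : ℝ) (v : E) : E :=
  v + ((cos t - 1) * ⟪a, v⟫_ℝ - sin t * ⟪b, v⟫_ℝ) • a +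
    ((cos t - 1) * ⟪b, v⟫_ℝ + sin t * ⟪a, v⟫_ℝ) • b

theorem planeRotation_zero (a b v : E) : planeRotation a b 0 v = v := by
  simp [planeRotation]

theorem planeRotation_add (a b : E) (t : ℝ) (v w : E) :
    planeRotation a b t (v + w) = planeRotation a b t v + planeRotation a b t w := by
  simp only [planeRotation, inner_add_right]
  module

theorem planeRotation_neg (a b : E) (t : ℝ) (v : E) :
    planeRotation a b t (-v) = -planeRotation a b t v := by
  simp only [planeRotation, inner_neg_right]
  module

theorem planeRotation_smul (a b : E) (t r : ℝ) (v : E) :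
    planeRotation a b t (r • v) = r • planeRotation a b t v := by
  simp only [planeRotation, inner_smul_right]
  module

variable {a b : E}

theorem inner_left_planeRotation (ha : ‖a‖ = 1) (hab : ⟪a, b⟫_ℝ = 0) (t : ℝ) (v : E) :
    ⟪a, planeRotation a b t v⟫_ℝ = cos t * ⟪a, v⟫_ℝ - sin t * ⟪b, v⟫_ℝ := by
  simp only [planeRotation, inner_add_right, inner_smul_right, hab,
    real_inner_self_eq_norm_sq, ha]
  ring

theorem inner_right_planeRotation (hb : ‖b‖ = 1) (hab : ⟪a, b⟫_ℝ = 0) (t : ℝ) (v : E) :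
    ⟪b, planeRotation a b t v⟫_ℝ = cos t * ⟪b, v⟫_ℝ + sin t * ⟪a, v⟫_ℝ := by
  simp only [planeRotation, inner_add_right, inner_smul_right, real_inner_comm a b, hab,
    real_inner_self_eq_norm_sq, hb]
  ring

theorem planeRotation_planeRotation (ha : ‖a‖ = 1) (hb : ‖b‖ = 1) (hab : ⟪a, b⟫_ℝ = 0)
    (s t : ℝ) (v : E) :
    planeRotation a b s (planeRotation a b t v) = planeRotation a b (s + t) v := by
  rw [planeRotation, inner_left_planeRotation ha hab, inner_right_planeRotation hb hab]
  simp only [planeRotation, cos_add, sin_add]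
  module

theorem norm_planeRotation (ha : ‖a‖ = 1) (hb : ‖b‖ = 1) (hab : ⟪a, b⟫_ℝ = 0) (t : ℝ) (v : E) :
    ‖planeRotation a b t v‖ = ‖v‖ := by
  rw [← sq_eq_sq₀ (norm_nonneg _) (norm_nonneg _)]
  have h : ∀ α β : ℝ, ‖v + α • a + β • b‖ ^ 2 =
      ‖v‖ ^ 2 + 2 * α * ⟪a, v⟫_ℝ + 2 * β * ⟪b, v⟫_ℝ + α ^ 2 + β ^ 2 := fun α β => by
    rw [norm_add_sq_real, norm_add_sq_real, inner_add_left, inner_smul_right, inner_smul_left,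
      inner_smul_right, inner_smul_right, hab, norm_smul, norm_smul, ha, hb,
      real_inner_comm a v, real_inner_comm b v]
    simp
    ring
  rw [planeRotation, h]
  linear_combination (⟪a, v⟫_ℝ ^ 2 + ⟪b, v⟫_ℝ ^ 2) * Real.sin_sq_add_cos_sq t

theorem planeRotation_pi_right (hb : ‖b‖ = 1) (hab : ⟪a, b⟫_ℝ = 0) :
    planeRotation a b π b = -b := by
  simp only [planeRotation, hab, real_inner_self_eq_norm_sq, hb, cos_pi, sin_pi]
  module

/-- The rotation angle, as a function of the square of the distance from the centre, of a twist of
the ball of radius `R`: it is `α` on the ball of radius `2 * R / 3` and vanishes off the ball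
of radius `R`. -/
noncomputable def twistAngle (α R s : ℝ) : ℝ :=
  α * (1 - smoothTransition ((9 * (s / R ^ 2) - 4) / 5))

theorem twistAngle_of_le {α R s : ℝ} (hR : 0 < R) (h : s ≤ (2 * R / 3) ^ 2) :
    twistAngle α R s = α := by
  have : s / R ^ 2 ≤ 4 / 9 := by rw [div_le_iff₀ (by positivity)]; linarith
  rw [twistAngle, smoothTransition.zero_of_nonpos (by linarith)]
  ring

theorem twistAngle_of_ge {α R s : ℝ} (hR : 0 < R) (h : R ^ 2 ≤ s) : twistAngle α R s = 0 := by
  have : 1 ≤ s / R ^ 2 := by rw [le_div_iff₀ (by positivity)]; linarith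
  rw [twistAngle, smoothTransition.one_of_one_le (by linarith)]
  ring

theorem twistAngle_neg (α R s : ℝ) : twistAngle (-α) R s = -twistAngle α R s := by
  simp [twistAngle]

/-- The twist of the ball with centre `c` and radius `R`: the points at distance at most `2 * R / 3`
from `c` are rotated about `c` by the angle `α`, in the plane spanned by `a` and `b`; the
rotation then fades out towards the boundary sphere, preserving the distance from `c`. -/
noncomputable def twist (a b c : E) (α R : ℝ) (x : E) : E :=
  c + planeRotation a b (twistAngle α R (‖x - c‖ ^ 2)) (x - c)

theorem contDiff_twist (a b c : E) (α R : ℝ) : ContDiff ℝ ∞ (twist a b c α R) := by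
  have h : ContDiff ℝ ∞ smoothTransition := smoothTransition.contDiff (n := ⊤)
  have h1 : ContDiff ℝ ∞ fun x : E => ‖x - c‖ ^ 2 :=
    (contDiff_id.sub contDiff_const).norm_sq ℝ
  have h2 : ContDiff ℝ ∞ fun x : E => twistAngle α R (‖x - c‖ ^ 2) := by
    unfold twistAngle
    refine contDiff_const.mul (contDiff_const.sub (h.comp ?_))
    fun_prop
  have hc := contDiff_cos.comp h2
  have hs := contDiff_sin.comp h2
  have ha : ContDiff ℝ ∞ fun x : E => ⟪a, x - c⟫_ℝ :=
    contDiff_const.inner ℝ (contDiff_id.sub contDiff_const)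
  have hb : ContDiff ℝ ∞ fun x : E => ⟪b, x - c⟫_ℝ :=
    contDiff_const.inner ℝ (contDiff_id.sub contDiff_const)
  unfold twist planeRotation
  exact contDiff_const.add (((contDiff_id.sub contDiff_const).add
    ((((hc.sub contDiff_const).mul ha).sub (hs.mul hb)).smul contDiff_const)).add
    ((((hc.sub contDiff_const).mul hb).add (hs.mul ha)).smul contDiff_const))

theorem twist_of_le {c x : E} {α R : ℝ} (hR : 0 < R) (h : ‖x - c‖ ≤ 2 * R / 3) :
    twist a b c α R x = c + planeRotation a b α (x - c) := by
  rw [twist, twistAngle_of_le hR (pow_le_pow_left₀ (norm_nonneg _) h 2)]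

theorem twist_of_ge {c x : E} {α R : ℝ} (hR : 0 < R) (h : R ≤ ‖x - c‖) :
    twist a b c α R x = x := by
  rw [twist, twistAngle_of_ge hR (pow_le_pow_left₀ hR.le h 2), planeRotation_zero,
    add_sub_cancel]

theorem twist_neg_twist (ha : ‖a‖ = 1) (hb : ‖b‖ = 1) (hab : ⟪a, b⟫_ℝ = 0) (c : E) (α R : ℝ)
    (x : E) : twist a b c (-α) R (twist a b c α R x) = x := by
  rw [twist, twist, add_sub_cancel_left, norm_planeRotation ha hb hab, twistAngle_neg,
    planeRotation_planeRotation ha hb hab, neg_add_cancel, planeRotation_zero, add_sub_cancel]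

theorem exists_norm_sub_le_of_eq_off_ball [FiniteDimensional ℝ E] {f : E → E}
    (hf : ContDiff ℝ ∞ f) {R : ℝ} (h : ∀ x, R ≤ ‖x‖ → f x = x) :
    ∃ M : ℝ, 0 ≤ M ∧ ∀ x y, ‖f x - f y‖ ≤ M * ‖x - y‖ := by
  have hcs : HasCompactSupport fun x => f x - x :=
    HasCompactSupport.of_support_subset_isCompact (isCompact_closedBall (0 : E) R) fun x hx => by
      rw [mem_closedBall_zero_iff]
      by_contra! hlt
      exact hx (by simp [h x hlt.le])
  obtain ⟨C, hC⟩ := ContDiff.lipschitzWith_of_hasCompactSupport (𝕂 := ℝ) hcs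
    (hf.sub contDiff_id) (by simp)
  refine ⟨C + 1, by positivity, fun x y => ?_⟩
  have := hC.norm_sub_le x y
  calc ‖f x - f y‖ = ‖((f x - x) - (f y - y)) + (x - y)‖ := by congr 1; abel
    _ ≤ C * ‖x - y‖ + ‖x - y‖ := (norm_add_le _ _).trans (add_le_add this le_rfl)
    _ = _ := by ring

/-- A diffeomorphism supported in a ball which exchanges two disjoint balls by translations. The
large ball is turned by `π`, which exchanges the two small balls but also turns them; each of them
is then turned back about its own centre. -/
theorem exists_exchange [FiniteDimensional ℝ E] (ha : ‖a‖ = 1) (hb : ‖b‖ = 1)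
    (hab : ⟪a, b⟫_ℝ = 0) {ρ : ℝ} (hρ : 0 < ρ) :
    ∃ (Ψ Ψ' : E → E) (M : ℝ), ContDiff ℝ ∞ Ψ ∧ ContDiff ℝ ∞ Ψ' ∧
      Function.LeftInverse Ψ' Ψ ∧ Function.RightInverse Ψ' Ψ ∧ 0 ≤ M ∧
      (∀ x y, ‖Ψ x - Ψ y‖ ≤ M * ‖x - y‖) ∧ (∀ x y, ‖Ψ' x - Ψ' y‖ ≤ M * ‖x - y‖) ∧
      (∀ x, 6 * ρ ≤ ‖x‖ → Ψ x = x) ∧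
      ∀ v, ‖v‖ < ρ → Ψ ((3 * ρ) • b + v) = -((3 * ρ) • b) + v ∧
        Ψ (-((3 * ρ) • b) + v) = (3 * ρ) • b + v := by
  set p : E := (3 * ρ) • b with hp
  have hpn : ‖p‖ = 3 * ρ := by rw [hp, norm_smul, hb, Real.norm_of_nonneg (by positivity), mul_one]
  have hrot : planeRotation a b π p = -p := by
    rw [hp, planeRotation_smul, planeRotation_pi_right hb hab, smul_neg]
  set S : E → E := fun x => twist a b p (-π) (3 / 2 * ρ) (twist a b (-p) (-π) (3 / 2 * ρ)
    (twist a b 0 π (6 * ρ) x)) with hS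
  set S' : E → E := fun x => twist a b 0 (-π) (6 * ρ) (twist a b (-p) π (3 / 2 * ρ)
    (twist a b p π (3 / 2 * ρ) x)) with hS'
  have hinv := twist_neg_twist (a := a) (b := b) ha hb hab
  have hinv' : ∀ (c : E) (α R : ℝ) (x : E), twist a b c α R (twist a b c (-α) R x) = x :=
    fun c α R x => by simpa using hinv c (-α) R x
  have hR : 0 < 3 / 2 * ρ := by positivity
  have hl : Function.LeftInverse S' S := fun x => by simp only [hS, hS', hinv', hinv]
  have hr : Function.RightInverse S' S := fun x => by simp only [hS, hS', hinv', hinv]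
  have hcS : ContDiff ℝ ∞ S := (contDiff_twist _ _ _ _ _).comp
    ((contDiff_twist _ _ _ _ _).comp (contDiff_twist _ _ _ _ _))
  have hcS' : ContDiff ℝ ∞ S' := (contDiff_twist _ _ _ _ _).comp
    ((contDiff_twist _ _ _ _ _).comp (contDiff_twist _ _ _ _ _))
  have hid : ∀ x, 6 * ρ ≤ ‖x‖ → S x = x := fun x hx => by
    have h1 : 3 / 2 * ρ ≤ ‖x - p‖ := by linarith [norm_sub_norm_le x p]
    have h2 : 3 / 2 * ρ ≤ ‖x - -p‖ := by linarith [norm_sub_norm_le x (-p), norm_neg p]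
    simp only [hS]
    rw [twist_of_ge (c := (0 : E)) (by positivity) (by simpa using hx), twist_of_ge hR h2,
      twist_of_ge hR h1]
  have hid' : ∀ x, 6 * ρ ≤ ‖x‖ → S' x = x := fun x hx => by
    conv_lhs => rw [← hid x hx]
    exact hl x
  have hback : ∀ v, planeRotation a b (-π) (planeRotation a b π v) = v := fun v => by
    rw [planeRotation_planeRotation ha hb hab, neg_add_cancel, planeRotation_zero]
  obtain ⟨M₁, hM₁, h1⟩ := exists_norm_sub_le_of_eq_off_ball hcS hid
  obtain ⟨M₂, hM₂, h2⟩ := exists_norm_sub_le_of_eq_off_ball hcS' hid'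
  refine ⟨S, S', max M₁ M₂, hcS, hcS', hl, hr, le_max_of_le_left hM₁,
    fun x y => (h1 x y).trans (by gcongr; exact le_max_left _ _),
    fun x y => (h2 x y).trans (by gcongr; exact le_max_right _ _), hid, fun v hv => ?_⟩
  have hpp : ‖p + p‖ = 6 * ρ := by
    rw [← two_smul ℝ p, norm_smul, hpn]; norm_num; ring
  have hw : ‖planeRotation a b π v‖ < ρ := by rwa [norm_planeRotation ha hb hab]
  constructor
  · have e1 : twist a b 0 π (6 * ρ) (p + v) = -p + planeRotation a b π v := by
      rw [twist_of_le (by positivity), zero_add, sub_zero, planeRotation_add, hrot]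
      rw [sub_zero]
      linarith [norm_add_le p v]
    simp only [hS]
    have e2 : -p + planeRotation a b π v - -p = planeRotation a b π v := add_sub_cancel_left _ _
    rw [e1, twist_of_le (c := -p) hR, e2, hback, twist_of_ge hR]
    · have := norm_sub_norm_le (-(p + p)) (-v)
      rw [norm_neg, norm_neg, hpp] at this
      rw [show -p + v - p = -(p + p) - -v by abel]
      linarith
    · rw [e2]
      linarith
  · have e1 : twist a b 0 π (6 * ρ) (-p + v) = p + planeRotation a b π v := by
      rw [twist_of_le (by positivity), zero_add, sub_zero, planeRotation_add, planeRotation_neg,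
        hrot, neg_neg]
      rw [sub_zero]
      linarith [norm_add_le (-p) v, norm_neg p]
    simp only [hS]
    rw [e1, twist_of_ge (c := -p) hR, twist_of_le (c := p) hR, add_sub_cancel_left, hback]
    · rw [add_sub_cancel_left]
      linarith
    · have := norm_sub_norm_le (p + p) (-planeRotation a b π v)
      rw [norm_neg, hpp] at this
      rw [show p + planeRotation a b π v - -p = (p + p) - -planeRotation a b π v by abel]
      linarith

end Twist

/-! ### Swapping the small cubes -/

/-- The centre of that half of `[0, 1]` which contains `t`. -/
noncomputable def side (t : ℝ) : ℝ := if 1 / 2 < t then 3 / 4 else 1 / 4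

/-- The magnification which takes each of the two intervals of length `r` centred at `1 / 4` and
`3 / 4` onto `[0, 1]`. -/
noncomputable def zoom (r t : ℝ) : ℝ := 1 / 2 + (t - side t) / r

theorem half_add_div_mem_iff {r c t : ℝ} (hr : 0 < r) :
    1 / 2 + (t - c) / r ∈ Icc (0 : ℝ) 1 ↔ |t - c| ≤ r / 2 := by
  rw [abs_le, mem_Icc, ← neg_le_iff_add_nonneg', ← le_sub_iff_add_le', le_div_iff₀ hr,
    div_le_iff₀ hr]
  constructor <;> rintro ⟨h1, h2⟩ <;> constructor <;> linarith

theorem zoom_mem_iff {r t : ℝ} (hr : 0 < r) : zoom r t ∈ Icc (0 : ℝ) 1 ↔ |t - side t| ≤ r / 2 :=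
  half_add_div_mem_iff hr

theorem side_eq_or (t : ℝ) : side t = 1 / 4 ∨ side t = 3 / 4 := by
  unfold side; split_ifs <;> simp

theorem side_eq_of_abs_sub_lt {s t : ℝ} (h : |t - side s| < 1 / 4) : side t = side s := by
  rw [abs_lt] at h
  unfold side at h ⊢
  split_ifs at h ⊢ <;> linarith

variable {n : ℕ}

/-- The centre `(1 / 2, …, 1 / 2)` of the cube. -/
noncomputable def mid (n : ℕ) : Space n := WithLp.toLp 2 fun _ => 1 / 2

/-- The centre of that one of the `2ⁿ` dyadic subcubes which contains `x`. -/
noncomputable def sideCenter (x : Space n) : Space n := WithLp.toLp 2 fun i => side (x i)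

/-- The magnification which takes each of the `2ⁿ` cubes of side `r`, concentric with the dyadic
subcubes, onto the whole cube. -/
noncomputable def zoomMap (r : ℝ) (x : Space n) : Space n := WithLp.toLp 2 fun i => zoom r (x i)

theorem mem_cube {x : Space n} : x ∈ cube n ↔ ∀ i, x i ∈ Icc (0 : ℝ) 1 := Iff.rfl

theorem zoomMap_eq (r : ℝ) (x : Space n) : zoomMap r x = mid n + r⁻¹ • (x - sideCenter x) := by
  ext i
  simp [zoomMap, mid, sideCenter, zoom, div_eq_inv_mul]

theorem sideCenter_add_smul_zoomMap {r : ℝ} (hr : r ≠ 0) (x : Space n) :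
    sideCenter x + r • (zoomMap r x - mid n) = x := by
  rw [zoomMap_eq, add_sub_cancel_left, smul_inv_smul₀ hr, add_sub_cancel]

theorem zoomMap_mem_cube_iff {r : ℝ} (hr : 0 < r) {x : Space n} :
    zoomMap r x ∈ cube n ↔ ∀ i, |x i - side (x i)| ≤ r / 2 :=
  forall_congr' fun _ => zoom_mem_iff hr

theorem norm_le_of_abs_le {v : Space n} {B : ℝ} (hB : 0 ≤ B) (h : ∀ i, |v i| ≤ B) :
    ‖v‖ ≤ n * B := by
  rw [EuclideanSpace.norm_eq]
  refine Real.sqrt_le_iff.2 ⟨by positivity, ?_⟩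
  have h1 : ∑ i, ‖v i‖ ^ 2 ≤ ∑ _i : Fin n, B ^ 2 :=
    Finset.sum_le_sum fun i _ => pow_le_pow_left₀ (norm_nonneg _) (h i) 2
  have h2 : (n : ℝ) ≤ (n : ℝ) ^ 2 := by exact_mod_cast Nat.le_self_pow two_ne_zero n
  simp only [Finset.sum_const, Finset.card_univ, Fintype.card_fin, nsmul_eq_mul] at h1
  nlinarith [sq_nonneg B, mul_le_mul_of_nonneg_right h2 (sq_nonneg B)]

theorem reflectLast_apply {l : Fin n} (hl : (l : ℕ) + 1 = n) (x : Space n) (i : Fin n) :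
    reflectLast x i = if i = l then 1 - x i else x i := by
  have : (i : ℕ) + 1 = n ↔ i = l := by rw [Fin.ext_iff]; omega
  simp only [reflectLast, this]

/-- A smooth `L`-Lipschitz map `G` which is the identity off the cube and which carries each
of the `2ⁿ` cubes of side `r` concentric with the dyadic subcubes to its mirror image, by a
translation (also in a neighbourhood of the small cube). -/
structure IsSwap (r L : ℝ) (G : Space n → Space n) : Prop where
  contDiff : ContDiff ℝ ∞ G
  eq_self : ∀ x, x ∉ cube n → G x = x
  eventually_eq : ∀ x, zoomMap r x ∈ cube n →
    ∀ᶠ y in 𝓝 x, G y = y + (reflectLast (sideCenter x) - sideCenter x)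
  norm_sub_le : ∀ x y, ‖G x - G y‖ ≤ L * ‖x - y‖

/-- The coordinatewise stretching of the gaps between the `2ⁿ` subcubes and the boundary of the
cube, and of the gap between the upper and the lower ones. The constant `6 * ρ - 1 / 2` is such that
the centres `1 / 4` and `3 / 4` in the last coordinate are taken to `-3 * ρ` and `3 * ρ`; the
complement of the cube is mapped to points at distance at least `6 * ρ` from the origin. -/
noncomputable def stretchMap (l : Fin n) (ρ δ : ℝ) : Space n → Space n :=
  coordMap fun i => stretch (6 * ρ) (if i = l then 6 * ρ - 1 / 2 else 0) δ

theorem stretch_zero_of_near {K δ t : ℝ} (hδ : 0 < δ)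
    (h : |t - 1 / 4| ≤ 1 / 4 - δ / 8 ∨ |t - 3 / 4| ≤ 1 / 4 - δ / 8) :
    stretch K 0 δ t = t - 1 / 2 := by
  rcases h with h | h <;> rw [abs_le] at h
  · rw [stretch_of_mem_left hδ (by linarith) (by linarith)]; ring
  · rw [stretch_of_mem_right hδ (by linarith) (by linarith)]; ring

theorem stretchMap_of_near_right {l : Fin n} {ρ δ : ℝ} (hδ : 0 < δ) {y : Space n}
    (h : ∀ i, |y i - 1 / 4| ≤ 1 / 4 - δ / 8 ∨ |y i - 3 / 4| ≤ 1 / 4 - δ / 8)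
    (hyl : |y l - 3 / 4| ≤ 1 / 4 - δ / 8) :
    stretchMap l ρ δ y = (3 * ρ) • EuclideanSpace.single l 1 +
      (y - mid n - (1 / 4 : ℝ) • EuclideanSpace.single l 1) := by
  ext i
  by_cases hi : i = l
  · subst hi
    rw [abs_le] at hyl
    simp only [stretchMap, coordMap, if_true, mid, PiLp.add_apply, PiLp.sub_apply, PiLp.smul_apply,
      PiLp.single_apply, smul_eq_mul]
    rw [stretch_of_mem_right hδ (by linarith) (by linarith)]
    ring
  · simp only [stretchMap, coordMap, if_neg hi, mid, PiLp.add_apply, PiLp.sub_apply,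
      PiLp.smul_apply, PiLp.single_apply, smul_eq_mul]
    rw [stretch_zero_of_near hδ (h i)]
    ring

theorem stretchMap_of_near_left {l : Fin n} {ρ δ : ℝ} (hδ : 0 < δ) {y : Space n}
    (h : ∀ i, |y i - 1 / 4| ≤ 1 / 4 - δ / 8 ∨ |y i - 3 / 4| ≤ 1 / 4 - δ / 8)
    (hyl : |y l - 1 / 4| ≤ 1 / 4 - δ / 8) :
    stretchMap l ρ δ y = -((3 * ρ) • EuclideanSpace.single l 1) +
      (y - mid n + (1 / 4 : ℝ) • EuclideanSpace.single l 1) := by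
  ext i
  by_cases hi : i = l
  · subst hi
    rw [abs_le] at hyl
    simp only [stretchMap, coordMap, if_true, mid, PiLp.add_apply, PiLp.sub_apply, PiLp.smul_apply,
      PiLp.single_apply, smul_eq_mul, PiLp.neg_apply]
    rw [stretch_of_mem_left hδ (by linarith) (by linarith)]
    ring
  · simp only [stretchMap, coordMap, if_neg hi, mid, PiLp.add_apply, PiLp.sub_apply,
      PiLp.smul_apply, PiLp.single_apply, smul_eq_mul, PiLp.neg_apply]
    rw [stretch_zero_of_near hδ (h i)]
    ring

/-- Conjugating an exchange of two balls by `stretchMap` gives a swap: the lower small cubes all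
lie in one of the balls after the stretching, and the upper ones in the other. -/
theorem isSwap_conj {l : Fin n} (hl : (l : ℕ) + 1 = n) {δ M M₁ : ℝ} (hδ : 0 < δ) (hδ1 : δ < 1)
    (hM : 0 ≤ M)
    {Ψ S' : Space n → Space n} (hΨ : ContDiff ℝ ∞ Ψ) (hΨM : ∀ x y, ‖Ψ x - Ψ y‖ ≤ M * ‖x - y‖)
    (hid : ∀ x, 6 * n ≤ ‖x‖ → Ψ x = x)
    (hex : ∀ v : Space n, ‖v‖ < n →
      Ψ ((3 * n : ℝ) • EuclideanSpace.single l 1 + v) =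
        -((3 * n : ℝ) • EuclideanSpace.single l 1) + v ∧
      Ψ (-((3 * n : ℝ) • EuclideanSpace.single l 1) + v) =
        (3 * n : ℝ) • EuclideanSpace.single l 1 + v)
    (hS : ∀ x y : Space n, ‖stretchMap l n δ x - stretchMap l n δ y‖ ≤ M₁ / δ * ‖x - y‖)
    (hS' : ContDiff ℝ ∞ S') (hS'1 : ∀ x y, ‖S' x - S' y‖ ≤ 1 * ‖x - y‖)
    (hinv : Function.LeftInverse S' (stretchMap l n δ)) :
    IsSwap ((1 - δ) / 2) (M * M₁ / δ) fun x => S' (Ψ (stretchMap l n δ x)) := by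
  have hn : 0 < n := by omega
  have hn' : (1 : ℝ) ≤ n := by exact_mod_cast hn
  refine ⟨hS'.comp (hΨ.comp (contDiff_coordMap fun i => contDiff_stretch _ _ _)), ?_, ?_, ?_⟩
  · intro x hx
    rw [hid, hinv]
    rw [mem_cube, not_forall] at hx
    obtain ⟨i, hi⟩ := hx
    have h1 : 6 * (n : ℝ) ≤ |stretchMap l n δ x i| := by
      refine le_abs_stretch ?_ hδ hδ1.le hi
      split_ifs
      · linarith
      · rfl
    exact h1.trans (PiLp.norm_apply_le (p := 2) (stretchMap l n δ x) i)
  · intro x hx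
    have hr : ∀ i, |x i - side (x i)| < 1 / 4 - δ / 8 := fun i => by
      have := (zoomMap_mem_cube_iff (by linarith)).1 hx i
      linarith
    have hev : ∀ᶠ y : Space n in 𝓝 x, ∀ i, |y i - side (x i)| < 1 / 4 - δ / 8 := by
      refine eventually_all.2 fun i => ?_
      have hc : ContinuousAt (fun y : Space n => |y i - side (x i)|) x := by fun_prop
      exact hc.eventually (gt_mem_nhds (hr i))
    filter_upwards [hev] with y hy
    have hnear : ∀ i, |y i - 1 / 4| ≤ 1 / 4 - δ / 8 ∨ |y i - 3 / 4| ≤ 1 / 4 - δ / 8 := fun i => by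
      rcases side_eq_or (x i) with h | h
      · left; simpa only [h] using (hy i).le
      · right; simpa only [h] using (hy i).le
    -- A neighbourhood of a lower cube is moved by `1 / 2` upwards, that of an upper cube downwards.
    rcases side_eq_or (x l) with h | h
    · have e0 : y + (reflectLast (sideCenter x) - sideCenter x) =
          y + (1 / 2 : ℝ) • EuclideanSpace.single l 1 := by
        congr 1
        ext i
        by_cases hi : i = l
        · subst hi
          simp [reflectLast_apply hl, sideCenter, h]; norm_num
        · simp [reflectLast_apply hl, hi]
      have hyl := hy l
      rw [h] at hyl
      have hyl' := abs_lt.1 hyl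
      have e1 := stretchMap_of_near_left (l := l) (ρ := n) hδ hnear hyl.le
      have e2 := stretchMap_of_near_right (l := l) (ρ := n) hδ
        (y := y + (1 / 2 : ℝ) • EuclideanSpace.single l 1) (fun i => by
          by_cases hi : i = l
          · subst hi
            right
            simp only [PiLp.add_apply, PiLp.smul_apply, PiLp.single_apply, if_true,
              smul_eq_mul]
            rw [abs_le]
            constructor <;> linarith
          · simpa [hi] using hnear i) (by
            simp only [PiLp.add_apply, PiLp.smul_apply, PiLp.single_apply, if_true,
              smul_eq_mul]
            rw [abs_le]
            constructor <;> linarith)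
      have hv : ‖y - mid n + (1 / 4 : ℝ) • EuclideanSpace.single l 1‖ < n := by
        refine (norm_le_of_abs_le (B := 1 / 2) (by norm_num) fun i => ?_).trans_lt (by linarith)
        have h2 := hnear i
        rw [abs_le, abs_le] at h2
        by_cases hi : i = l
        · subst hi
          simp only [mid, PiLp.add_apply, PiLp.sub_apply, PiLp.smul_apply,
            PiLp.single_apply, if_true, smul_eq_mul]
          rw [abs_le]
          constructor <;> linarith
        · simp only [mid, PiLp.add_apply, PiLp.sub_apply, PiLp.smul_apply,
            PiLp.single_apply, if_neg hi, smul_eq_mul]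
          rw [abs_le]
          constructor <;> rcases h2 with h2 | h2 <;> linarith
      rw [e0, e1, (hex _ hv).2, ← hinv (y + (1 / 2 : ℝ) • EuclideanSpace.single l 1), e2]
      congr 2
      module
    · have e0 : y + (reflectLast (sideCenter x) - sideCenter x) =
          y - (1 / 2 : ℝ) • EuclideanSpace.single l 1 := by
        rw [sub_eq_add_neg y]
        congr 1
        ext i
        by_cases hi : i = l
        · subst hi
          simp [reflectLast_apply hl, sideCenter, h]; norm_num
        · simp [reflectLast_apply hl, hi]
      have hyl := hy l
      rw [h] at hyl
      have hyl' := abs_lt.1 hyl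
      have e1 := stretchMap_of_near_right (l := l) (ρ := n) hδ hnear hyl.le
      have e2 := stretchMap_of_near_left (l := l) (ρ := n) hδ
        (y := y - (1 / 2 : ℝ) • EuclideanSpace.single l 1) (fun i => by
          by_cases hi : i = l
          · subst hi
            left
            simp only [PiLp.sub_apply, PiLp.smul_apply, PiLp.single_apply, if_true,
              smul_eq_mul]
            rw [abs_le]
            constructor <;> linarith
          · simpa [hi] using hnear i) (by
            simp only [PiLp.sub_apply, PiLp.smul_apply, PiLp.single_apply, if_true,
              smul_eq_mul]
            rw [abs_le]
            constructor <;> linarith)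
      have hv : ‖y - mid n - (1 / 4 : ℝ) • EuclideanSpace.single l 1‖ < n := by
        refine (norm_le_of_abs_le (B := 1 / 2) (by norm_num) fun i => ?_).trans_lt (by linarith)
        have h2 := hnear i
        rw [abs_le, abs_le] at h2
        by_cases hi : i = l
        · subst hi
          simp only [mid, PiLp.sub_apply, PiLp.smul_apply,
            PiLp.single_apply, if_true, smul_eq_mul]
          rw [abs_le]
          constructor <;> linarith
        · simp only [mid, PiLp.sub_apply, PiLp.smul_apply,
            PiLp.single_apply, if_neg hi, smul_eq_mul]
          rw [abs_le]
          constructor <;> rcases h2 with h2 | h2 <;> linarith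
      rw [e0, e1, (hex _ hv).1, ← hinv (y - (1 / 2 : ℝ) • EuclideanSpace.single l 1), e2]
      congr 2
      module
  · intro x y
    have h1 := hS'1 (Ψ (stretchMap l n δ x)) (Ψ (stretchMap l n δ y))
    rw [one_mul] at h1
    calc _ ≤ _ := h1
      _ ≤ _ := hΨM _ _
      _ ≤ M * (M₁ / δ * ‖x - y‖) := by gcongr; exact hS x y
      _ = _ := by ring

/-- Swaps exist for gaps of any relative size `δ`, with Lipschitz constants of order `1 / δ`. -/
theorem exists_isSwap (hn : 2 ≤ n) : ∃ L : ℝ, 1 ≤ L ∧ ∀ δ, 0 < δ → δ < 1 →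
    ∃ G G' : Space n → Space n, IsSwap ((1 - δ) / 2) (L / δ) G ∧ IsSwap ((1 - δ) / 2) (L / δ) G' ∧
      Function.LeftInverse G' G ∧ Function.RightInverse G' G := by
  let i₀ : Fin n := ⟨0, by omega⟩
  let l : Fin n := ⟨n - 1, by omega⟩
  have hl : (l : ℕ) + 1 = n := Nat.sub_add_cancel (by omega)
  have hne : i₀ ≠ l := by
    intro h
    have := congrArg Fin.val h
    simp only [i₀, l] at this
    omega
  have hn' : (1 : ℝ) ≤ n := by exact_mod_cast (by omega : 1 ≤ n)
  obtain ⟨Ψ, Ψ', M, hΨ, hΨ', hinv, hinv', hM, hΨM, hΨM', hid, hex⟩ :=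
    exists_exchange (a := EuclideanSpace.single i₀ (1 : ℝ)) (b := EuclideanSpace.single l (1 : ℝ))
      (by simp) (by simp) (by simp [EuclideanSpace.inner_single_left, hne])
      (ρ := n) (by linarith)
  obtain ⟨M₁, hM₁, h1⟩ := exists_abs_stretch_sub_le (K₀ := 6 * n) (K₁ := 6 * n - 1 / 2)
    (by linarith) (by linarith)
  obtain ⟨M₂, hM₂, h2⟩ := exists_abs_stretch_sub_le (K₀ := 6 * n) (K₁ := 0)
    (by linarith) le_rfl
  refine ⟨max 1 (M * max M₁ M₂), le_max_left _ _, fun δ hδ hδ1 => ?_⟩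
  have hK : ∀ i : Fin n, (0 : ℝ) ≤ if i = l then 6 * (n : ℝ) - 1 / 2 else 0 := fun i => by
    split_ifs
    · linarith
    · rfl
  choose g hg hgl hgr hg1 using fun i : Fin n => exists_contDiff_inverse
    (contDiff_stretch (6 * n) (if i = l then 6 * n - 1 / 2 else 0) δ)
    (monotone_stretch_sub (by linarith) (hK i) hδ)
  have hS : ∀ x y : Space n,
      ‖stretchMap l n δ x - stretchMap l n δ y‖ ≤ max M₁ M₂ / δ * ‖x - y‖ :=
    norm_coordMap_sub_le (by positivity) fun i a b => by
      by_cases hi : i = l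
      · simp only [hi, if_true]
        refine (h1 δ hδ hδ1.le a b).trans ?_
        gcongr
        exact le_max_left _ _
      · simp only [if_neg hi]
        refine (h2 δ hδ hδ1.le a b).trans ?_
        gcongr
        exact le_max_right _ _
  have hS'1 : ∀ x y : Space n, ‖coordMap g x - coordMap g y‖ ≤ 1 * ‖x - y‖ :=
    norm_coordMap_sub_le zero_le_one fun i a b => by simpa using hg1 i a b
  have hl' : Function.LeftInverse (coordMap g) (stretchMap l n δ) := fun x => by
    ext i
    exact hgl i (x i)
  have hr' : Function.RightInverse (coordMap g) (stretchMap l n δ) := fun x => by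
    ext i
    exact hgr i (x i)
  have hmono : ∀ {G : Space n → Space n}, IsSwap ((1 - δ) / 2) (M * max M₁ M₂ / δ) G →
      IsSwap ((1 - δ) / 2) (max 1 (M * max M₁ M₂) / δ) G := fun h =>
    ⟨h.contDiff, h.eq_self, h.eventually_eq, fun x y => (h.norm_sub_le x y).trans (by
      gcongr
      exact le_max_right _ _)⟩
  refine ⟨_, _, hmono (isSwap_conj hl hδ hδ1 hM hΨ hΨM hid hex hS (contDiff_coordMap hg) hS'1 hl'),
    hmono (isSwap_conj hl hδ hδ1 hM hΨ' hΨM' (fun x hx => ?_) (fun v hv => ⟨?_, ?_⟩) hS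
      (contDiff_coordMap hg) hS'1 hl'), fun x => ?_, fun x => ?_⟩
  · conv_lhs => rw [← hid x hx]
    exact hinv x
  · rw [← (hex v hv).2, hinv]
  · rw [← (hex v hv).1, hinv]
  · simp only
    rw [hr', hinv, hl']
  · simp only
    rw [hr', hinv', hl']

/-! ### Iterated swaps -/

/-- The image of `y` under the homothety which takes the cube onto the cube of side `r` with
centre `e`. -/
noncomputable def place (r : ℝ) (e y : Space n) : Space n := e + r • (y - mid n)

theorem side_side (t : ℝ) : side (side t) = side t := by
  unfold side; split_ifs <;> norm_num at *

theorem side_one_sub_side (t : ℝ) : side (1 - side t) = 1 - side t := by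
  rcases side_eq_or t with h | h <;> rw [h] <;> unfold side <;> norm_num

theorem sideCenter_sideCenter (x : Space n) : sideCenter (sideCenter x) = sideCenter x := by
  ext i
  exact side_side _

theorem sideCenter_reflectLast_sideCenter (x : Space n) :
    sideCenter (reflectLast (sideCenter x)) = reflectLast (sideCenter x) := by
  ext i
  simp only [sideCenter, reflectLast]
  split_ifs
  · exact side_one_sub_side _
  · exact side_side _

theorem abs_sub_half_le {t : ℝ} (h : t ∈ Icc (0 : ℝ) 1) : |t - 1 / 2| ≤ 1 / 2 := by
  rw [abs_le]; constructor <;> linarith [h.1, h.2]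

theorem sideCenter_place {r : ℝ} (hr : 0 < r) (hr' : r < 1 / 2) {e y : Space n}
    (he : sideCenter e = e) (hy : y ∈ cube n) : sideCenter (place r e y) = e := by
  ext i
  have h1 : side (e i) = e i := congrArg (fun v : Space n => v i) he
  have h2 := abs_sub_half_le (hy i)
  have h3 : |r * (y i - 1 / 2)| < 1 / 4 := by
    rw [abs_mul, abs_of_pos hr]
    nlinarith
  have : side (place r e y i) = side (e i) := by
    refine side_eq_of_abs_sub_lt ?_
    simpa [place, mid, h1] using h3
  exact this.trans h1

theorem zoomMap_place {r : ℝ} (hr : 0 < r) (hr' : r < 1 / 2) {e y : Space n}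
    (he : sideCenter e = e) (hy : y ∈ cube n) : zoomMap r (place r e y) = y := by
  rw [zoomMap_eq, sideCenter_place hr hr' he hy, place, add_sub_cancel_left,
    inv_smul_smul₀ hr.ne', add_sub_cancel]

theorem place_sideCenter_zoomMap {r : ℝ} (hr : 0 < r) (x : Space n) :
    place r (sideCenter x) (zoomMap r x) = x :=
  sideCenter_add_smul_zoomMap hr.ne' x

theorem reflectLast_place (r : ℝ) (e y : Space n) :
    reflectLast (place r e y) = place r (reflectLast e) (reflectLast y) := by
  ext i
  simp only [reflectLast, place, mid, PiLp.add_apply, PiLp.smul_apply, PiLp.sub_apply, smul_eq_mul]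
  split_ifs <;> ring

theorem reflectLast_reflectLast (x : Space n) : reflectLast (reflectLast x) = x := by
  ext i
  simp only [reflectLast]
  split_ifs <;> ring

theorem reflectLast_mem_cube {x : Space n} (hx : x ∈ cube n) : reflectLast x ∈ cube n := by
  intro i
  have := hx i
  simp only [reflectLast]
  split_ifs
  · constructor <;> linarith [this.1, this.2]
  · exact this

theorem norm_place_sub {r : ℝ} (hr : 0 < r) (e y z : Space n) :
    ‖place r e y - place r e z‖ = r * ‖y - z‖ := by
  rw [place, place, add_sub_add_left_eq_sub, ← smul_sub, sub_sub_sub_cancel_right, norm_smul,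
    Real.norm_of_nonneg hr.le]

theorem norm_sub_le_of_mem_cube {x y : Space n} (hx : x ∈ cube n) (hy : y ∈ cube n) :
    ‖x - y‖ ≤ n := by
  rw [← mul_one (n : ℝ)]
  refine norm_le_of_abs_le zero_le_one fun i => ?_
  rw [PiLp.sub_apply, abs_le]
  constructor <;> linarith [(hx i).1, (hx i).2, (hy i).1, (hy i).2]

theorem side_of_abs_sub_le_left {r t : ℝ} (hr' : r < 1 / 2) (h : |t - 1 / 4| ≤ r / 2) :
    side t = 1 / 4 := by
  rw [side, if_neg]; rw [abs_le] at h; linarith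

theorem side_of_abs_sub_le_right {r t : ℝ} (hr' : r < 1 / 2) (h : |t - 3 / 4| ≤ r / 2) :
    side t = 3 / 4 := by
  rw [side, if_pos]; rw [abs_le] at h; linarith

theorem zoom_mem_iff_or {r t : ℝ} (hr : 0 < r) (hr' : r < 1 / 2) :
    zoom r t ∈ Icc (0 : ℝ) 1 ↔ |t - 1 / 4| ≤ r / 2 ∨ |t - 3 / 4| ≤ r / 2 := by
  rw [zoom_mem_iff hr]
  constructor
  · intro h
    rcases side_eq_or t with h' | h' <;> rw [h'] at h
    · exact Or.inl h
    · exact Or.inr h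
  · rintro (h | h)
    · rwa [side_of_abs_sub_le_left hr' h]
    · rwa [side_of_abs_sub_le_right hr' h]

theorem isClosed_setOf_zoomMap_mem {r : ℝ} (hr : 0 < r) (hr' : r < 1 / 2) :
    IsClosed {x : Space n | zoomMap r x ∈ cube n} := by
  have : {x : Space n | zoomMap r x ∈ cube n} =
      ⋂ i, ({x : Space n | |x i - 1 / 4| ≤ r / 2} ∪ {x : Space n | |x i - 3 / 4| ≤ r / 2}) := by
    ext x
    simp only [mem_ofPred_eq, mem_iInter, mem_union]
    exact forall_congr' fun i => zoom_mem_iff_or hr hr'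
  rw [this]
  refine isClosed_iInter fun i => IsClosed.union ?_ ?_ <;>
    exact isClosed_le (by fun_prop) continuous_const

theorem eventually_sideCenter_eq {r : ℝ} (hr : 0 < r) (hr' : r < 1 / 2) {x : Space n}
    (hx : zoomMap r x ∈ cube n) : ∀ᶠ y in 𝓝 x, sideCenter y = sideCenter x := by
  have hev : ∀ᶠ y : Space n in 𝓝 x, ∀ i, |y i - side (x i)| < 1 / 4 := by
    refine eventually_all.2 fun i => ?_
    have hc : ContinuousAt (fun y : Space n => |y i - side (x i)|) x := by fun_prop
    refine hc.eventually (gt_mem_nhds ?_)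
    have := (zoomMap_mem_cube_iff hr).1 hx i
    linarith
  filter_upwards [hev] with y hy
  ext i
  exact side_eq_of_abs_sub_lt (hy i)

theorem zoomMap_mem_cube_imp {r : ℝ} (hr : 0 < r) (hr' : r < 1 / 2) {x : Space n}
    (hx : zoomMap r x ∈ cube n) : x ∈ cube n := fun i => by
  rcases (zoom_mem_iff_or hr hr').1 (hx i) with h | h <;> rw [abs_le] at h <;>
    constructor <;> linarith

/-- The map which acts in each of the `2ⁿ` cubes of side `r`, concentric with the dyadic subcubes,
as a scaled copy of `f`. -/
noncomputable def replicate (r : ℝ) (f : Space n → Space n) (x : Space n) : Space n :=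
  place r (sideCenter x) (f (zoomMap r x))

section replicate
variable {r : ℝ} {f : Space n → Space n}

theorem sideCenter_replicate (hr : 0 < r) (hr' : r < 1 / 2) (hf : MapsTo f (cube n) (cube n))
    {x : Space n} (hx : zoomMap r x ∈ cube n) : sideCenter (replicate r f x) = sideCenter x :=
  sideCenter_place hr hr' (sideCenter_sideCenter x) (hf hx)

theorem zoomMap_replicate (hr : 0 < r) (hr' : r < 1 / 2) (hf : MapsTo f (cube n) (cube n))
    {x : Space n} (hx : zoomMap r x ∈ cube n) : zoomMap r (replicate r f x) = f (zoomMap r x) :=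
  zoomMap_place hr hr' (sideCenter_sideCenter x) (hf hx)

theorem replicate_eq_self (hr : 0 < r) {x : Space n} (hx : f (zoomMap r x) = zoomMap r x) :
    replicate r f x = x := by
  rw [replicate, hx, place_sideCenter_zoomMap hr]

theorem replicate_eventuallyEq_of_mem (hr : 0 < r) (hr' : r < 1 / 2) {x : Space n}
    (hx : zoomMap r x ∈ cube n) : replicate r f =ᶠ[𝓝 x]
      fun y => sideCenter x + r • (f (mid n + r⁻¹ • (y - sideCenter x)) - mid n) := by
  filter_upwards [eventually_sideCenter_eq hr hr' hx] with y hy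
  rw [replicate, place, zoomMap_eq, hy]

theorem replicate_eventuallyEq_id (hr : 0 < r) (hr' : r < 1 / 2) (hf : ∀ y, y ∉ cube n → f y = y)
    {x : Space n} (hx : zoomMap r x ∉ cube n) : replicate r f =ᶠ[𝓝 x] id := by
  filter_upwards [(isClosed_setOf_zoomMap_mem hr hr').isOpen_compl.mem_nhds hx] with y hy
  exact replicate_eq_self hr (hf _ hy)

theorem contDiff_replicate (hr : 0 < r) (hr' : r < 1 / 2) (hf : ∀ y, y ∉ cube n → f y = y)
    (hfc : ContDiff ℝ ∞ f) : ContDiff ℝ ∞ (replicate r f) := by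
  refine contDiff_iff_contDiffAt.2 fun x => ?_
  by_cases hx : zoomMap r x ∈ cube n
  · refine ContDiffAt.congr_of_eventuallyEq ?_ (replicate_eventuallyEq_of_mem hr hr' hx)
    refine ContDiff.contDiffAt ?_
    exact contDiff_const.add (((hfc.comp (contDiff_const.add
      ((contDiff_id.sub contDiff_const).const_smul r⁻¹))).sub contDiff_const).const_smul r)
  · exact contDiffAt_id.congr_of_eventuallyEq (replicate_eventuallyEq_id hr hr' hf hx)

theorem hasFDerivAt_replicate (hr : 0 < r) (hr' : r < 1 / 2) {x : Space n}
    (hx : zoomMap r x ∈ cube n) {D : Space n →L[ℝ] Space n}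
    (hD : HasFDerivAt f D (zoomMap r x)) : HasFDerivAt (replicate r f) D x := by
  refine HasFDerivAt.congr_of_eventuallyEq ?_ (replicate_eventuallyEq_of_mem hr hr' hx)
  rw [zoomMap_eq] at hD
  have h1 : HasFDerivAt (fun y : Space n => mid n + r⁻¹ • (y - sideCenter x))
      (r⁻¹ • ContinuousLinearMap.id ℝ (Space n)) x :=
    (((hasFDerivAt_id x).sub_const _).const_smul r⁻¹).const_add _
  have h2 := (((hD.comp x h1).sub_const (mid n)).const_smul r).const_add (sideCenter x)
  refine h2.congr_fderiv ?_
  ext1 v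
  simp [smul_smul, hr.ne']

end replicate

theorem mapsTo_cube_of_injective {f : Space n → Space n} (hf : Function.Injective f)
    (hid : ∀ y, y ∉ cube n → f y = y) : MapsTo f (cube n) (cube n) := fun x hx => by
  by_contra h
  exact h (by rwa [hf (hid _ h)])

namespace IsSwap
variable {r L : ℝ} {G : Space n → Space n}

theorem apply_eq (h : IsSwap r L G) (hr : 0 < r) {x : Space n} (hx : zoomMap r x ∈ cube n) :
    G x = place r (reflectLast (sideCenter x)) (zoomMap r x) := by
  have h1 := (h.eventually_eq x hx).self_of_nhds
  have h2 := place_sideCenter_zoomMap hr x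
  rw [place] at h2 ⊢
  rw [h1]
  nth_rw 1 [← h2]
  abel

theorem sideCenter_apply (h : IsSwap r L G) (hr : 0 < r) (hr' : r < 1 / 2) {x : Space n}
    (hx : zoomMap r x ∈ cube n) : sideCenter (G x) = reflectLast (sideCenter x) := by
  rw [h.apply_eq hr hx, sideCenter_place hr hr' (sideCenter_reflectLast_sideCenter x) hx]

theorem zoomMap_apply (h : IsSwap r L G) (hr : 0 < r) (hr' : r < 1 / 2) {x : Space n}
    (hx : zoomMap r x ∈ cube n) : zoomMap r (G x) = zoomMap r x := by
  rw [h.apply_eq hr hx, zoomMap_place hr hr' (sideCenter_reflectLast_sideCenter x) hx]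

theorem hasFDerivAt (h : IsSwap r L G) {x : Space n} (hx : zoomMap r x ∈ cube n) :
    HasFDerivAt G (ContinuousLinearMap.id ℝ (Space n)) x :=
  ((hasFDerivAt_id x).add_const _).congr_of_eventuallyEq (h.eventually_eq x hx)

theorem norm_fderiv_le (h : IsSwap r L G) (hL : 0 ≤ L) (x : Space n) : ‖fderiv ℝ G x‖ ≤ L := by
  have : LipschitzWith ⟨L, hL⟩ G := LipschitzWith.of_dist_le_mul fun x y => by
    rw [dist_eq_norm, dist_eq_norm]
    exact h.norm_sub_le x y
  exact norm_fderiv_le_of_lipschitz ℝ this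

end IsSwap

/-- Swaps `G m` for cubes of relative side `r m`, together with inverses `G' m` which are
swaps as well. -/
structure IsSwapSeq (r L : ℕ → ℝ) (G G' : ℕ → Space n → Space n) : Prop where
  pos : ∀ m, 0 < r m
  lt_half : ∀ m, r m < 1 / 2
  isSwap : ∀ m, IsSwap (r m) (L m) (G m)
  isSwap' : ∀ m, IsSwap (r m) (L m) (G' m)
  leftInverse : ∀ m, Function.LeftInverse (G' m) (G m)
  rightInverse : ∀ m, Function.RightInverse (G' m) (G m)

theorem IsSwapSeq.symm {r L : ℕ → ℝ} {G G' : ℕ → Space n → Space n} (h : IsSwapSeq r L G G') :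
    IsSwapSeq r L G' G :=
  ⟨h.pos, h.lt_half, h.isSwap', h.isSwap, h.rightInverse, h.leftInverse⟩

/-- The map swapping the subcubes of `k` successive generations: `iter r G k m` uses the
swaps `G m, …, G (m + k - 1)`. It acts in the subcubes of the first generation as scaled copies of
`iter r G (k - 1) (m + 1)`, followed by `G m`. -/
noncomputable def iter (r : ℕ → ℝ) (G : ℕ → Space n → Space n) : ℕ → ℕ → Space n → Space n
  | 0, _ => id
  | k + 1, m => G m ∘ replicate (r m) (iter r G k (m + 1))

/-- The `k`-th stage of the construction of a symmetric Cantor set in `[0, 1]`, in which an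
interval of generation `j` has two children, of relative length `r (m + j)`. -/
noncomputable def cantorLevel (r : ℕ → ℝ) : ℕ → ℕ → Set ℝ
  | 0, _ => Icc 0 1
  | k + 1, m => {t | zoom (r m) t ∈ cantorLevel r k (m + 1)}

/-- The union of the `2 ^ (n * k)` cubes of generation `k`. -/
def level (n : ℕ) (r : ℕ → ℝ) (k m : ℕ) : Set (Space n) := {x | ∀ i, x i ∈ cantorLevel r k m}

theorem mem_level_succ {r : ℕ → ℝ} {k m : ℕ} {x : Space n} :
    x ∈ level n r (k + 1) m ↔ zoomMap (r m) x ∈ level n r k (m + 1) := Iff.rfl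

namespace IsSwapSeq
variable {r L : ℕ → ℝ} {G G' : ℕ → Space n → Space n}

theorem level_succ_subset (h : IsSwapSeq r L G G') (k : ℕ) :
    ∀ m, level n r (k + 1) m ⊆ level n r k m := by
  induction k with
  | zero => exact fun m x hx => zoomMap_mem_cube_imp (h.pos m) (h.lt_half m) hx
  | succ k ih => exact fun m x hx => mem_level_succ.2 (ih (m + 1) (mem_level_succ.1 hx))

theorem level_subset_of_le (h : IsSwapSeq r L G G') {j k : ℕ} (hjk : j ≤ k) (m : ℕ) :
    level n r k m ⊆ level n r j m :=
  antitone_nat_of_succ_le (f := fun k => level n r k m) (fun k => h.level_succ_subset k m) hjk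

theorem level_subset_cube (h : IsSwapSeq r L G G') (k m : ℕ) : level n r k m ⊆ cube n :=
  h.level_subset_of_le (Nat.zero_le k) m

theorem iter_eq_self (h : IsSwapSeq r L G G') (k : ℕ) :
    ∀ m x, x ∉ cube n → iter r G k m x = x := by
  induction k with
  | zero => exact fun m x _ => rfl
  | succ k ih =>
    intro m x hx
    have hz : zoomMap (r m) x ∉ cube n := fun hz =>
      hx (zoomMap_mem_cube_imp (h.pos m) (h.lt_half m) hz)
    rw [iter, Function.comp_apply, replicate_eq_self (h.pos m) (ih _ _ hz),
      (h.isSwap m).eq_self x hx]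

/-- A swap moves the small cubes as wholes, so it does not interfere with what happens inside them.
Hence the inverse of an iterate is built from the inverse swaps in the same order. -/
theorem leftInverse_iter (h : IsSwapSeq r L G G') (k : ℕ) :
    ∀ m, Function.LeftInverse (iter r G' k m) (iter r G k m) := by
  induction k with
  | zero => exact fun m x => rfl
  | succ k ih =>
    intro m x
    have hr := h.pos m
    have hr' := h.lt_half m
    have hid := h.iter_eq_self k (m + 1)
    have hid' := h.symm.iter_eq_self k (m + 1)
    have hmaps := mapsTo_cube_of_injective (ih (m + 1)).injective hid
    set f := iter r G k (m + 1) with hf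
    set g := iter r G' k (m + 1) with hg
    simp only [iter, Function.comp_apply, ← hf, ← hg]
    by_cases hx : zoomMap (r m) x ∈ cube n
    · have z1 := zoomMap_replicate hr hr' hmaps hx
      have s1 := sideCenter_replicate hr hr' hmaps hx
      have hz1 : zoomMap (r m) (replicate (r m) f x) ∈ cube n := by rw [z1]; exact hmaps hx
      have z2 := (h.isSwap m).zoomMap_apply hr hr' hz1
      have s2 := (h.isSwap m).sideCenter_apply hr hr' hz1
      rw [z1] at z2
      rw [s1] at s2
      have e : replicate (r m) g (G m (replicate (r m) f x)) = G m x := by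
        rw [replicate, z2, s2, hf, hg, ih (m + 1), (h.isSwap m).apply_eq hr hx]
      rw [e, h.leftInverse m]
    · have hG : zoomMap (r m) (G m x) ∉ cube n := fun hz => by
        have := (h.isSwap' m).zoomMap_apply hr hr' hz
        rw [h.leftInverse m] at this
        exact hx (this ▸ hz)
      rw [replicate_eq_self hr (hid _ hx), replicate_eq_self hr (hid' _ hG), h.leftInverse m]

theorem mapsTo_iter_cube (h : IsSwapSeq r L G G') (k m : ℕ) :
    MapsTo (iter r G k m) (cube n) (cube n) :=
  mapsTo_cube_of_injective (h.leftInverse_iter k m).injective (h.iter_eq_self k m)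

theorem iter_succ_of_mem (h : IsSwapSeq r L G G') (k m : ℕ) {x : Space n}
    (hx : zoomMap (r m) x ∈ cube n) : iter r G (k + 1) m x =
      place (r m) (reflectLast (sideCenter x)) (iter r G k (m + 1) (zoomMap (r m) x)) := by
  have hmaps := h.mapsTo_iter_cube k (m + 1)
  have z1 := zoomMap_replicate (h.pos m) (h.lt_half m) hmaps hx
  rw [iter, Function.comp_apply, (h.isSwap m).apply_eq (h.pos m) (by rw [z1]; exact hmaps hx), z1,
    sideCenter_replicate (h.pos m) (h.lt_half m) hmaps hx]

theorem mapsTo_iter_level (h : IsSwapSeq r L G G') (k : ℕ) :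
    ∀ m, MapsTo (iter r G k m) (level n r k m) (level n r k m) := by
  induction k with
  | zero => exact fun m x hx => hx
  | succ k ih =>
    intro m x hx
    have hz := h.level_subset_cube k (m + 1) (mem_level_succ.1 hx)
    rw [h.iter_succ_of_mem k m hz, mem_level_succ, zoomMap_place (h.pos m) (h.lt_half m)
      (sideCenter_reflectLast_sideCenter x) (h.mapsTo_iter_cube k (m + 1) hz)]
    exact ih (m + 1) hx

theorem iter_succ_eq (k : ℕ) : ∀ m x, IsSwapSeq r L G G' → x ∉ level n r k m →
    iter r G (k + 1) m x = iter r G k m x := by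
  induction k with
  | zero => exact fun m x h hx => h.iter_eq_self 1 m x hx
  | succ k ih =>
    intro m x h hx
    rw [iter, Function.comp_apply, replicate, ih (m + 1) _ h hx]
    rfl

theorem iter_eq_of_le (h : IsSwapSeq r L G G') {j k m : ℕ} (hjk : j ≤ k) {x : Space n}
    (hx : x ∉ level n r j m) : iter r G k m x = iter r G j m x := by
  induction k, hjk using Nat.le_induction with
  | base => rfl
  | succ k hjk ih =>
    rw [iter_succ_eq k m x h fun hk => hx (h.level_subset_of_le hjk m hk), ih]

/-- From generation `k` on, all iterates carry a cube of generation `k` to the same cube. -/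
theorem norm_iter_sub_iter_le (h : IsSwapSeq r L G G') (k : ℕ) :
    ∀ j m x, k ≤ j → x ∈ level n r k m →
      ‖iter r G j m x - iter r G k m x‖ ≤ n * (1 / 2) ^ k := by
  induction k with
  | zero =>
    intro j m x _ hx
    rw [pow_zero, mul_one]
    exact norm_sub_le_of_mem_cube (h.mapsTo_iter_cube j m hx) hx
  | succ k ih =>
    intro j m x hj hx
    obtain ⟨j, rfl⟩ : ∃ i, j = i + 1 := ⟨j - 1, by omega⟩
    have hz := h.level_subset_cube k (m + 1) (mem_level_succ.1 hx)
    rw [h.iter_succ_of_mem j m hz, h.iter_succ_of_mem k m hz, norm_place_sub (h.pos m), pow_succ']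
    have := ih j (m + 1) _ (by omega) (mem_level_succ.1 hx)
    calc _ ≤ 1 / 2 * (n * (1 / 2 : ℝ) ^ k) :=
          mul_le_mul (h.lt_half m).le this (norm_nonneg _) (by norm_num)
      _ = _ := by ring

/-- An iterate carries a cube of generation `k` to its mirror image, though by a translation. -/
theorem norm_iter_sub_reflectLast_le (h : IsSwapSeq r L G G') (k : ℕ) :
    ∀ m x, x ∈ level n r k m → ‖iter r G k m x - reflectLast x‖ ≤ n * (1 / 2) ^ k := by
  induction k with
  | zero =>
    intro m x hx
    rw [pow_zero, mul_one]
    exact norm_sub_le_of_mem_cube hx (reflectLast_mem_cube hx)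
  | succ k ih =>
    intro m x hx
    have hz := h.level_subset_cube k (m + 1) (mem_level_succ.1 hx)
    have e := reflectLast_place (r m) (sideCenter x) (zoomMap (r m) x)
    rw [place_sideCenter_zoomMap (h.pos m)] at e
    rw [h.iter_succ_of_mem k m hz, e, norm_place_sub (h.pos m), pow_succ']
    calc _ ≤ 1 / 2 * (n * (1 / 2 : ℝ) ^ k) :=
          mul_le_mul (h.lt_half m).le (ih (m + 1) _ hx) (norm_nonneg _) (by norm_num)
      _ = _ := by ring

theorem zoomMap_reflectLast (h : IsSwapSeq r L G G') (m : ℕ) {x : Space n}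
    (hx : zoomMap (r m) x ∈ cube n) :
    zoomMap (r m) (reflectLast x) = reflectLast (zoomMap (r m) x) := by
  have e := reflectLast_place (r m) (sideCenter x) (zoomMap (r m) x)
  rw [place_sideCenter_zoomMap (h.pos m)] at e
  rw [e, zoomMap_place (h.pos m) (h.lt_half m) (sideCenter_reflectLast_sideCenter x)
    (reflectLast_mem_cube hx)]

theorem reflectLast_mem_level (h : IsSwapSeq r L G G') (k : ℕ) :
    ∀ m x, x ∈ level n r k m → reflectLast x ∈ level n r k m := by
  induction k with
  | zero => exact fun m x hx => reflectLast_mem_cube hx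
  | succ k ih =>
    intro m x hx
    rw [mem_level_succ,
      h.zoomMap_reflectLast m (h.level_subset_cube k (m + 1) (mem_level_succ.1 hx))]
    exact ih (m + 1) _ hx

theorem contDiff_iter (h : IsSwapSeq r L G G') (k : ℕ) : ∀ m, ContDiff ℝ ∞ (iter r G k m) := by
  induction k with
  | zero => exact fun m => contDiff_id
  | succ k ih =>
    exact fun m => (h.isSwap m).contDiff.comp
      (contDiff_replicate (h.pos m) (h.lt_half m) (h.iter_eq_self k (m + 1)) (ih (m + 1)))

/-- The derivative of an iterate is at each point the derivative of a single swap, since a swap acts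
by translation on the small cubes, in which the further swaps take place. -/
theorem norm_fderiv_iter_le (h : IsSwapSeq r L G G') {B : ℝ} (hB : 1 ≤ B) (k : ℕ) :
    ∀ m, (∀ j < k, L (m + j) ≤ B) → (∀ j, 0 ≤ L j) → ∀ x, ‖fderiv ℝ (iter r G k m) x‖ ≤ B := by
  induction k with
  | zero =>
    intro m _ _ x
    rw [iter, fderiv_id]
    exact ContinuousLinearMap.norm_id_le.trans hB
  | succ k ih =>
    intro m hL hL0 x
    by_cases hx : zoomMap (r m) x ∈ cube n
    · have hmaps := h.mapsTo_iter_cube k (m + 1)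
      have hD := hasFDerivAt_replicate (h.pos m) (h.lt_half m) hx
        ((h.contDiff_iter k (m + 1)).differentiable (by simp) (zoomMap (r m) x)).hasFDerivAt
      have hG := (h.isSwap m).hasFDerivAt
        (x := replicate (r m) (iter r G k (m + 1)) x) (by
          rw [zoomMap_replicate (h.pos m) (h.lt_half m) hmaps hx]
          exact hmaps hx)
      rw [iter, (hG.comp x hD).fderiv, ContinuousLinearMap.id_comp]
      refine ih (m + 1) (fun j hj => ?_) hL0 _
      have := hL (j + 1) (by omega)
      rwa [show m + (j + 1) = m + 1 + j by omega] at this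
    · have : iter r G (k + 1) m =ᶠ[𝓝 x] G m := by
        filter_upwards [replicate_eventuallyEq_id (h.pos m) (h.lt_half m)
          (h.iter_eq_self k (m + 1)) hx] with y hy
        rw [iter, Function.comp_apply, hy, id]
      rw [this.fderiv_eq]
      exact ((h.isSwap m).norm_fderiv_le (hL0 m) x).trans (hL 0 (by omega))

theorem norm_iter_sub_le (h : IsSwapSeq r L G G') {B : ℝ} (hB : 1 ≤ B) (k m : ℕ)
    (hL : ∀ j < k, L (m + j) ≤ B) (hL0 : ∀ j, 0 ≤ L j) (x y : Space n) :
    ‖iter r G k m x - iter r G k m y‖ ≤ B * ‖x - y‖ :=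
  convex_univ.norm_image_sub_le_of_norm_fderiv_le
    (fun z _ => (h.contDiff_iter k m).differentiable (by simp) z)
    (fun z _ => h.norm_fderiv_iter_le hB k m hL hL0 z) (mem_univ y) (mem_univ x)

end IsSwapSeq

/-! ### The Cantor set -/

/-- The intersection of the stages `cantorLevel r k m`, `k ∈ ℕ`. -/
def cantorLimit (r : ℕ → ℝ) (m : ℕ) : Set ℝ := ⋂ k, cantorLevel r k m

theorem ne_half_of_zoom_mem {r t : ℝ} (hr : 0 < r) (hr' : r < 1 / 2)
    (h : zoom r t ∈ Icc (0 : ℝ) 1) : t ≠ 1 / 2 := by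
  rintro rfl
  rw [zoom_mem_iff hr, side, if_neg (lt_irrefl _), abs_le] at h
  linarith [h.2]

section Line
variable {r : ℕ → ℝ}

theorem cantorLevel_succ_subset (hr : ∀ m, 0 < r m) (hr' : ∀ m, r m < 1 / 2) (k : ℕ) :
    ∀ m, cantorLevel r (k + 1) m ⊆ cantorLevel r k m := by
  induction k with
  | zero =>
    intro m t ht
    rcases (zoom_mem_iff_or (hr m) (hr' m)).1 ht with h | h <;> rw [abs_le] at h <;>
      constructor <;> linarith [hr' m]
  | succ k ih => exact fun m t ht => ih (m + 1) ht

theorem antitone_cantorLevel (hr : ∀ m, 0 < r m) (hr' : ∀ m, r m < 1 / 2) (m : ℕ) :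
    Antitone fun k => cantorLevel r k m :=
  antitone_nat_of_succ_le fun k => cantorLevel_succ_subset hr hr' k m

theorem cantorLevel_subset (hr : ∀ m, 0 < r m) (hr' : ∀ m, r m < 1 / 2) (k m : ℕ) :
    cantorLevel r k m ⊆ Icc 0 1 :=
  antitone_cantorLevel hr hr' m (Nat.zero_le k)

theorem zoom_mem_cantorLimit (hr : ∀ m, 0 < r m) (hr' : ∀ m, r m < 1 / 2) {m : ℕ} {t : ℝ} :
    zoom (r m) t ∈ cantorLimit r (m + 1) ↔ t ∈ cantorLimit r m := by
  simp only [cantorLimit, mem_iInter]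
  exact ⟨fun h k => cantorLevel_succ_subset hr hr' k m (h k), fun h k => h (k + 1)⟩

theorem cantorLevel_succ (hr : ∀ m, 0 < r m) (hr' : ∀ m, r m < 1 / 2) (k m : ℕ) :
    cantorLevel r (k + 1) m =
      (fun t => 1 / 2 + (t - 1 / 4) / r m) ⁻¹' cantorLevel r k (m + 1) ∪
      (fun t => 1 / 2 + (t - 3 / 4) / r m) ⁻¹' cantorLevel r k (m + 1) := by
  ext t
  constructor
  · intro ht
    have h : 1 / 2 + (t - side t) / r m ∈ cantorLevel r k (m + 1) := ht
    rcases side_eq_or t with h' | h' <;> rw [h'] at h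
    · exact Or.inl h
    · exact Or.inr h
  · rintro (ht | ht)
    · have h := (half_add_div_mem_iff (hr m)).1 (cantorLevel_subset hr hr' _ _ ht)
      change 1 / 2 + (t - side t) / r m ∈ cantorLevel r k (m + 1)
      rwa [side_of_abs_sub_le_left (hr' m) h]
    · have h := (half_add_div_mem_iff (hr m)).1 (cantorLevel_subset hr hr' _ _ ht)
      change 1 / 2 + (t - side t) / r m ∈ cantorLevel r k (m + 1)
      rwa [side_of_abs_sub_le_right (hr' m) h]

theorem isClosed_cantorLevel (hr : ∀ m, 0 < r m) (hr' : ∀ m, r m < 1 / 2) (k : ℕ) :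
    ∀ m, IsClosed (cantorLevel r k m) := by
  induction k with
  | zero => exact fun m => isClosed_Icc
  | succ k ih =>
    intro m
    rw [cantorLevel_succ hr hr']
    exact ((ih (m + 1)).preimage (by fun_prop)).union ((ih (m + 1)).preimage (by fun_prop))

theorem volume_preimage_affine {ρ : ℝ} (hρ : 0 < ρ) (c : ℝ) (S : Set ℝ) :
    volume ((fun t => 1 / 2 + (t - c) / ρ) ⁻¹' S) = ENNReal.ofReal ρ * volume S := by
  have : (fun t => 1 / 2 + (t - c) / ρ) ⁻¹' S =
      (fun t => ρ⁻¹ * t) ⁻¹' ((fun t => t + (1 / 2 - ρ⁻¹ * c)) ⁻¹' S) := by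
    ext t
    simp only [mem_preimage]
    rw [show 1 / 2 + (t - c) / ρ = ρ⁻¹ * t + (1 / 2 - ρ⁻¹ * c) by ring]
  rw [this, Real.volume_preimage_mul_left (inv_ne_zero hρ.ne'), inv_inv, abs_of_pos hρ,
    measure_preimage_add_right]

theorem volume_cantorLevel_succ (hr : ∀ m, 0 < r m) (hr' : ∀ m, r m < 1 / 2) (k m : ℕ) :
    volume (cantorLevel r (k + 1) m) =
      ENNReal.ofReal (2 * r m) * volume (cantorLevel r k (m + 1)) := by
  rw [cantorLevel_succ hr hr', measure_union _
    (((isClosed_cantorLevel hr hr' k (m + 1)).preimage (by fun_prop)).measurableSet),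
    volume_preimage_affine (hr m), volume_preimage_affine (hr m),
    ENNReal.ofReal_mul zero_le_two, ← two_mul, ENNReal.ofReal_ofNat, mul_assoc]
  refine Set.disjoint_left.2 fun t h1 h2 => ?_
  have h1 := side_of_abs_sub_le_left (hr' m)
    ((half_add_div_mem_iff (hr m)).1 (cantorLevel_subset hr hr' _ _ h1))
  have h2 := side_of_abs_sub_le_right (hr' m)
    ((half_add_div_mem_iff (hr m)).1 (cantorLevel_subset hr hr' _ _ h2))
  rw [h1] at h2
  norm_num at h2

theorem le_volume_cantorLevel (hr : ∀ m, 0 < r m) (hr' : ∀ m, r m < 1 / 2) (k : ℕ) :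
    ∀ m, ENNReal.ofReal (1 - ∑ j ∈ Finset.range k, (1 - 2 * r (m + j))) ≤
      volume (cantorLevel r k m) := by
  induction k with
  | zero => intro m; simp [cantorLevel]
  | succ k ih =>
    intro m
    rw [volume_cantorLevel_succ hr hr']
    refine le_trans ?_ (mul_le_mul_right (ih (m + 1)) _)
    rw [← ENNReal.ofReal_mul (by linarith [hr m])]
    refine ENNReal.ofReal_le_ofReal ?_
    rw [Finset.sum_range_succ']
    have h0 : 0 ≤ ∑ j ∈ Finset.range k, (1 - 2 * r (m + 1 + j)) :=
      Finset.sum_nonneg fun j _ => by linarith [hr' (m + 1 + j)]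
    have e : ∀ j, r (m + (j + 1)) = r (m + 1 + j) := fun j => by congr 1; omega
    simp only [e, add_zero]
    nlinarith [hr' m]

theorem volume_cantorLimit_pos (hr : ∀ m, 0 < r m) (hr' : ∀ m, r m < 1 / 2)
    (hs : ∀ k, ∑ j ∈ Finset.range k, (1 - 2 * r j) ≤ 1 / 2) : 0 < volume (cantorLimit r 0) := by
  have ht := tendsto_measure_iInter_atTop (μ := volume) (s := fun k => cantorLevel r k 0)
    (fun k => (isClosed_cantorLevel hr hr' k 0).nullMeasurableSet) (antitone_cantorLevel hr hr' 0)
    ⟨0, by simp [cantorLevel]⟩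
  have : ENNReal.ofReal (1 / 2) ≤ volume (cantorLimit r 0) := by
    refine ge_of_tendsto' ht fun k => ?_
    refine le_trans (ENNReal.ofReal_le_ofReal ?_) (le_volume_cantorLevel hr hr' k 0)
    simp only [zero_add]
    linarith [hs k]
  exact lt_of_lt_of_le (by simp) this

/-- The Cantor set contains no long interval, since an interval in it lies on one side of the
middle gap, and is therefore magnified by `zoom` to an interval in the next Cantor set. -/
theorem sub_le_of_Icc_subset_cantorLimit (hr : ∀ m, 0 < r m) (hr' : ∀ m, r m < 1 / 2) (k : ℕ) :
    ∀ m a b, a ≤ b → Icc a b ⊆ cantorLimit r m → b - a ≤ (1 / 2) ^ k := by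
  induction k with
  | zero =>
    intro m a b hab h
    have ha := mem_iInter.1 (h (left_mem_Icc.2 hab)) 0
    have hb := mem_iInter.1 (h (right_mem_Icc.2 hab)) 0
    simp only [cantorLevel, mem_Icc] at ha hb
    rw [pow_zero]
    linarith
  | succ k ih =>
    intro m a b hab h
    have hside : ∀ t ∈ Icc a b, side t = side a := by
      intro t ht
      have h1 : (1 / 2 : ℝ) ∉ Icc a b := fun h2 =>
        ne_half_of_zoom_mem (hr m) (hr' m) (mem_iInter.1 (h h2) 1) rfl
      rw [mem_Icc, not_and_or, not_le, not_le] at h1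
      unfold side
      rcases h1 with h1 | h1
      · rw [if_pos h1, if_pos (h1.trans_le ht.1)]
      · rw [if_neg (by linarith [ht.2]), if_neg (by linarith)]
    have hb := hside b (right_mem_Icc.2 hab)
    have hz : b - a = r m * (zoom (r m) b - zoom (r m) a) := by
      rw [zoom, zoom, hb]
      field_simp [(hr m).ne']
      ring
    have hza : zoom (r m) a ≤ zoom (r m) b := by
      by_contra! hlt
      nlinarith [mul_pos (hr m) (sub_pos.2 hlt)]
    have := ih (m + 1) (zoom (r m) a) (zoom (r m) b) hza fun s hs => by
      have e1 : r m * (zoom (r m) a - 1 / 2) = a - side a := by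
        rw [zoom]; field_simp [(hr m).ne']; ring
      have e2 : r m * (zoom (r m) b - 1 / 2) = b - side a := by
        rw [zoom, hb]; field_simp [(hr m).ne']; ring
      have ht : side a + r m * (s - 1 / 2) ∈ Icc a b := by
        have h1 := mul_le_mul_of_nonneg_left hs.1 (hr m).le
        have h2 := mul_le_mul_of_nonneg_left hs.2 (hr m).le
        constructor <;> linarith
      have h3 := (zoom_mem_cantorLimit hr hr').2 (h ht)
      rw [zoom, hside _ ht, add_sub_cancel_left, mul_div_cancel_left₀ _ (hr m).ne',
        add_sub_cancel] at h3
      exact h3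
    rw [hz, pow_succ']
    exact mul_le_mul (hr' m).le this (by linarith) (by norm_num)

end Line

/-- The Cantor set in `ℝⁿ`: the `n`-th power of a Cantor set in the line. -/
def limitSet (n : ℕ) (r : ℕ → ℝ) (m : ℕ) : Set (Space n) := {x | ∀ k, x ∈ level n r k m}

theorem mem_limitSet_iff {r : ℕ → ℝ} {m : ℕ} {x : Space n} :
    x ∈ limitSet n r m ↔ ∀ i, x i ∈ cantorLimit r m := by
  simp only [cantorLimit, mem_iInter]
  exact forall_comm

theorem exists_mul_half_pow_lt (c : ℝ) {ε : ℝ} (hε : 0 < ε) : ∃ k : ℕ, c * (1 / 2 : ℝ) ^ k < ε := by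
  have : Tendsto (fun k : ℕ => c * (1 / 2 : ℝ) ^ k) atTop (𝓝 (c * 0)) :=
    (tendsto_pow_atTop_nhds_zero_of_lt_one (by norm_num) (by norm_num)).const_mul c
  rw [mul_zero] at this
  exact (this.eventually (gt_mem_nhds hε)).exists

namespace IsSwapSeq
variable {r L : ℕ → ℝ} {G G' : ℕ → Space n → Space n}

theorem zoomMap_mem_limitSet (h : IsSwapSeq r L G G') {m : ℕ} {x : Space n} :
    zoomMap (r m) x ∈ limitSet n r (m + 1) ↔ x ∈ limitSet n r m := by
  rw [mem_limitSet_iff, mem_limitSet_iff]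
  exact forall_congr' fun i => zoom_mem_cantorLimit h.pos h.lt_half

theorem isClosed_level (h : IsSwapSeq r L G G') (k m : ℕ) : IsClosed (level n r k m) := by
  have : level n r k m = ⋂ i, (fun x : Space n => x i) ⁻¹' cantorLevel r k m := by
    ext x
    simp only [mem_iInter, mem_preimage]
    rfl
  rw [this]
  exact isClosed_iInter fun i => (isClosed_cantorLevel h.pos h.lt_half k m).preimage (by fun_prop)

theorem isClosed_limitSet (h : IsSwapSeq r L G G') (m : ℕ) : IsClosed (limitSet n r m) := by
  have : limitSet n r m = ⋂ k, level n r k m := by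
    ext x
    simp only [mem_iInter]
    rfl
  rw [this]
  exact isClosed_iInter fun k => h.isClosed_level k m

theorem limitSet_subset_cube (r : ℕ → ℝ) (m : ℕ) : limitSet n r m ⊆ cube n :=
  fun _ hx => hx 0

theorem reflectLast_mem_limitSet (h : IsSwapSeq r L G G') {m : ℕ} {x : Space n}
    (hx : x ∈ limitSet n r m) : reflectLast x ∈ limitSet n r m :=
  fun k => h.reflectLast_mem_level k m x (hx k)

theorem limitSet_subset_interior (h : IsSwapSeq r L G G') (m : ℕ) :
    limitSet n r m ⊆ interior (cube n) := by
  have ho : IsOpen (⋂ i, (fun x : Space n => x i) ⁻¹' Ioo (0 : ℝ) 1) :=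
    isOpen_iInter_of_finite fun i => isOpen_Ioo.preimage (by fun_prop)
  refine Subset.trans ?_ (interior_maximal (s := cube n) (fun x hx i => ?_) ho)
  · intro x hx
    refine mem_iInter.2 fun i => ?_
    have hr' := h.lt_half m
    rcases (zoom_mem_iff_or (h.pos m) hr').1 (hx 1 i) with h1 | h1 <;> rw [abs_le] at h1 <;>
      constructor <;> linarith
  · exact Ioo_subset_Icc_self (mem_iInter.1 hx i)

theorem volume_limitSet_pos (h : IsSwapSeq r L G G')
    (hs : ∀ k, ∑ j ∈ Finset.range k, (1 - 2 * r j) ≤ 1 / 2) : 0 < volume (limitSet n r 0) := by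
  have e : WithLp.toLp 2 ⁻¹' limitSet n r 0 = Set.pi univ fun _ : Fin n => cantorLimit r 0 := by
    ext x
    rw [mem_preimage, mem_limitSet_iff, mem_univ_pi]
  rw [← (PiLp.volume_preserving_toLp (Fin n)).measure_preimage
    (h.isClosed_limitSet 0).nullMeasurableSet, e, volume_pi_pi]
  simp only [Finset.prod_const]
  exact ENNReal.pow_pos (volume_cantorLimit_pos h.pos h.lt_half hs) _

theorem reflectLast_ne (h : IsSwapSeq r L G G') (hn : 0 < n) {m : ℕ} {x : Space n}
    (hx : x ∈ limitSet n r m) : reflectLast x ≠ x := fun he => by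
  let l : Fin n := ⟨n - 1, by omega⟩
  have hl : (l : ℕ) + 1 = n := Nat.sub_add_cancel hn
  have h1 := congrArg (fun v : Space n => v l) he
  simp only [reflectLast_apply hl, if_true] at h1
  exact ne_half_of_zoom_mem (h.pos m) (h.lt_half m) (hx 1 l) (by linarith)

theorem exists_mem_limitSet_near (h : IsSwapSeq r L G G') (hn : 0 < n) (k : ℕ) :
    ∀ m, ∀ x ∈ limitSet n r m, ∃ y ∈ limitSet n r m, y ≠ x ∧ ‖y - x‖ ≤ n * (1 / 2) ^ k := by
  induction k with
  | zero =>
    intro m x hx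
    refine ⟨reflectLast x, h.reflectLast_mem_limitSet hx, h.reflectLast_ne hn hx, ?_⟩
    rw [pow_zero, mul_one]
    exact norm_sub_le_of_mem_cube (reflectLast_mem_cube (hx 0)) (hx 0)
  | succ k ih =>
    intro m x hx
    obtain ⟨y, hy, hne, hle⟩ := ih (m + 1) _ (h.zoomMap_mem_limitSet.2 hx)
    have hzy := zoomMap_place (h.pos m) (h.lt_half m) (sideCenter_sideCenter x) (hy 0)
    refine ⟨place (r m) (sideCenter x) y, h.zoomMap_mem_limitSet.1 (by rwa [hzy]), ?_, ?_⟩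
    · intro he
      rw [he] at hzy
      exact hne hzy.symm
    · have e := norm_place_sub (h.pos m) (sideCenter x) y (zoomMap (r m) x)
      rw [place_sideCenter_zoomMap (h.pos m)] at e
      rw [e, pow_succ']
      calc _ ≤ 1 / 2 * (n * (1 / 2 : ℝ) ^ k) :=
            mul_le_mul (h.lt_half m).le hle (norm_nonneg _) (by norm_num)
        _ = _ := by ring

theorem isCantorSet_limitSet (h : IsSwapSeq r L G G') (hn : 0 < n)
    (hs : ∀ k, ∑ j ∈ Finset.range k, (1 - 2 * r j) ≤ 1 / 2) : IsCantorSet (limitSet n r 0) where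
  nonempty := nonempty_of_measure_ne_zero (h.volume_limitSet_pos hs).ne'
  isCompact := by
    refine Metric.isCompact_of_isClosed_isBounded (h.isClosed_limitSet 0) ?_
    refine (Metric.isBounded_iff.2 ⟨n, fun x hx y hy => ?_⟩).subset (limitSet_subset_cube r 0)
    rw [dist_eq_norm]
    exact norm_sub_le_of_mem_cube hx hy
  perfect := by
    refine ⟨h.isClosed_limitSet 0, fun x hx => ?_⟩
    rw [accPt_iff_nhds]
    intro U hU
    obtain ⟨ε, hε, hball⟩ := Metric.mem_nhds_iff.1 hU
    obtain ⟨k, hk⟩ := exists_mul_half_pow_lt n hε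
    obtain ⟨y, hy, hne, hle⟩ := h.exists_mem_limitSet_near hn k 0 x hx
    exact ⟨y, ⟨hball (by rw [Metric.mem_ball, dist_eq_norm]; linarith), hy⟩, hne⟩
  isTotallyDisconnected := by
    intro S hS hconn x hx y hy
    have key : ∀ x ∈ S, ∀ y ∈ S, ∀ i, y i ≤ x i := fun x hx y hy i => by
      by_contra! hlt
      have hc : IsPreconnected ((fun z : Space n => z i) '' S) :=
        hconn.image _ (by fun_prop)
      have hsub : Icc (x i) (y i) ⊆ cantorLimit r 0 := fun t ht => by
        obtain ⟨z, hz, rfl⟩ := hc.Icc_subset (mem_image_of_mem _ hx) (mem_image_of_mem _ hy) ht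
        exact mem_limitSet_iff.1 (hS hz) i
      obtain ⟨k, hk⟩ := exists_mul_half_pow_lt 1 (sub_pos.2 hlt)
      have := sub_le_of_Icc_subset_cantorLimit h.pos h.lt_half k 0 _ _ hlt.le hsub
      linarith
    ext i
    exact le_antisymm (key y hy x hx i) (key x hx y hy i)

end IsSwapSeq

/-! ### The choice of the gaps -/

section Modulus
variable {φ : ℝ → ℝ}

theorem mul_le_mul_of_concaveOn (hφ : ConcaveOn ℝ (Ici 0) φ) (h0 : φ 0 = 0) {s t : ℝ} (hs : 0 ≤ s)
    (hst : s ≤ t) : s * φ t ≤ t * φ s := by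
  rcases (hs.trans hst).eq_or_lt with ht | ht
  · have : s = 0 := le_antisymm (hst.trans ht.ge) hs
    simp [this, ← ht, h0]
  · have h1 := hφ.2 (mem_Ici.2 ht.le) (mem_Ici.2 (le_refl (0 : ℝ)))
      (show 0 ≤ s / t by positivity)
      (show 0 ≤ 1 - s / t by rw [sub_nonneg, div_le_one ht]; exact hst)
      (by ring)
    simp only [smul_eq_mul, h0, mul_zero, add_zero] at h1
    rw [div_mul_cancel₀ _ ht.ne', div_mul_eq_mul_div, div_le_iff₀ ht] at h1
    linarith

/-- The gaps: `d k` is determined by `φ (d k) = φ 1 / 2 ^ k`. The integral of `1 / φ` over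
`[d (k + 1), d k]` is at least `(d k - d (k + 1)) * 2 ^ k / φ 1`, and concavity gives
`d (k + 1) ≤ d k / 2`; hence the integrability of `1 / φ` makes `∑ 2 ^ k * d k` converge. -/
theorem exists_gaps (hφ_mono : StrictMonoOn φ (Ici 0)) (hφ_concave : ConcaveOn ℝ (Ici 0) φ)
    (hφ_cont : ContinuousOn φ (Ici 0)) (hφ_zero : φ 0 = 0)
    (hφ_int : IntegrableOn (fun s : ℝ => 1 / φ s) (Ioc 0 1)) :
    ∃ d : ℕ → ℝ, d 0 = 1 ∧ (∀ k, 0 < d k) ∧ (∀ k, φ (d k) = φ 1 * (1 / 2) ^ k) ∧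
      (∀ k, d (k + 1) ≤ d k / 2) ∧ Summable fun k => 2 ^ k * d k := by
  have hpos : ∀ t, 0 < t → 0 < φ t := fun t ht => by
    rw [← hφ_zero]
    exact hφ_mono (mem_Ici.2 le_rfl) (mem_Ici.2 ht.le) ht
  have h1 := hpos 1 one_pos
  have hex : ∀ k : ℕ, ∃ t ∈ Icc (0 : ℝ) 1, φ t = φ 1 * (1 / 2) ^ k := fun k => by
    refine intermediate_value_Icc zero_le_one (hφ_cont.mono Icc_subset_Ici_self) ⟨?_, ?_⟩
    · rw [hφ_zero]; positivity
    · exact mul_le_of_le_one_right h1.le (pow_le_one₀ (by norm_num) (by norm_num))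
  choose d hd hφd using hex
  have hdpos : ∀ k, 0 < d k := fun k => (hd k).1.lt_of_ne fun h => by
    have h2 := hφd k
    rw [← h, hφ_zero] at h2
    have : 0 < φ 1 * (1 / 2 : ℝ) ^ k := by positivity
    linarith
  have hd0 : d 0 = 1 := hφ_mono.injOn (hd 0).1 (mem_Ici.2 zero_le_one) (by rw [hφd 0]; simp)
  have hhalf : ∀ k, d (k + 1) ≤ d k / 2 := fun k => by
    have hk := hdpos k
    rw [← hφ_mono.le_iff_le (hd (k + 1)).1 (mem_Ici.2 (by linarith)), hφd]
    have := mul_le_mul_of_concaveOn hφ_concave hφ_zero (s := d k / 2) (t := d k) (by linarith)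
      (by linarith)
    rw [hφd] at this
    have h3 : d k * (φ 1 * (1 / 2) ^ (k + 1)) ≤ d k * φ (d k / 2) := by
      rw [pow_succ]
      linarith
    exact le_of_mul_le_mul_left h3 hk
  refine ⟨d, hd0, hdpos, hφd, hhalf, ?_⟩
  have hii : ∀ a b, 0 ≤ a → a ≤ b → b ≤ 1 →
      IntervalIntegrable (fun s => 1 / φ s) volume a b := fun a b ha hab hb => by
    rw [intervalIntegrable_iff_integrableOn_Ioc_of_le hab]
    exact hφ_int.mono_set (Ioc_subset_Ioc ha hb)
  have hpart : ∀ N, ∑ k ∈ Finset.range N, 2 ^ k * d k ≤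
      2 * φ 1 * ∫ s in (d N)..1, 1 / φ s := fun N => by
    induction N with
    | zero => simp [hd0]
    | succ N ih =>
      have hle : d (N + 1) ≤ d N := (hhalf N).trans (by linarith [hdpos N])
      rw [Finset.sum_range_succ, ← intervalIntegral.integral_add_adjacent_intervals
        (hii _ _ (hdpos _).le hle (hd N).2) (hii _ _ (hdpos _).le (hd N).2 le_rfl), mul_add]
      have hc : ∫ _s in (d (N + 1))..(d N), 1 / φ (d N) ≤ ∫ s in (d (N + 1))..(d N), 1 / φ s := by
        refine intervalIntegral.integral_mono_on hle (by simp)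
          (hii _ _ (hdpos _).le hle (hd N).2) fun s hs => ?_
        have hs0 : 0 < s := (hdpos _).trans_le hs.1
        exact one_div_le_one_div_of_le (hpos s hs0)
          (hφ_mono.monotoneOn hs0.le (hdpos N).le hs.2)
      rw [intervalIntegral.integral_const, smul_eq_mul, hφd] at hc
      have e : 2 * φ 1 * ((d N - d (N + 1)) * (1 / (φ 1 * (1 / 2) ^ N))) =
          2 * (d N - d (N + 1)) * 2 ^ N := by
        rw [one_div_pow]
        field_simp
      have h4 := mul_le_mul_of_nonneg_left hc (by positivity : 0 ≤ 2 * φ 1)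
      rw [e] at h4
      have h5 : (2 : ℝ) ^ N * d N ≤ 2 * (d N - d (N + 1)) * 2 ^ N := by
        rw [mul_comm]
        exact mul_le_mul_of_nonneg_right (by linarith [hhalf N]) (by positivity)
      linarith
  refine summable_of_sum_range_le (c := 2 * φ 1 * ∫ s in (0 : ℝ)..1, 1 / φ s)
    (fun k => by have := hdpos k; positivity) fun N => (hpart N).trans ?_
  refine mul_le_mul_of_nonneg_left ?_ (by positivity)
  rw [← intervalIntegral.integral_add_adjacent_intervals
    (hii 0 _ le_rfl (hdpos N).le (hd N).2) (hii _ _ (hdpos N).le (hd N).2 le_rfl)]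
  refine le_add_of_nonneg_left (intervalIntegral.integral_nonneg (hdpos N).le fun s hs => ?_)
  rcases hs.1.eq_or_lt with h | h
  · simp [← h, hφ_zero]
  · exact (one_div_pos.2 (hpos s h)).le

end Modulus

/-! ### The limit map -/

theorem exists_mem_Ioc_of_halving {d : ℕ → ℝ} (h0 : d 0 = 1)
    (hd : ∀ k, d (k + 1) ≤ d k / 2) {t : ℝ} (ht : 0 < t) (ht1 : t ≤ 1) :
    ∃ k, d (k + 1) < t ∧ t ≤ d k := by
  have hle : ∀ k, d k ≤ 1 * (1 / 2) ^ k := fun k => by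
    induction k with
    | zero => simp [h0]
    | succ k ih => rw [pow_succ]; linarith [hd k]
  have hex : ∃ k, d k < t := by
    obtain ⟨k, hk⟩ := exists_mul_half_pow_lt 1 ht
    exact ⟨k, (hle k).trans_lt hk⟩
  classical
  obtain ⟨k, hk⟩ : ∃ k, Nat.find hex = k + 1 := by
    refine Nat.exists_eq_succ_of_ne_zero fun h => ?_
    have := Nat.find_spec hex
    rw [h, h0] at this
    linarith
  refine ⟨k, hk ▸ Nat.find_spec hex, not_lt.1 (Nat.find_min hex (by omega))⟩

theorem isClosed_cube : IsClosed (cube n) := by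
  have : cube n = ⋂ i, (fun x : Space n => x i) ⁻¹' Icc (0 : ℝ) 1 := by
    ext x
    simp only [mem_iInter, mem_preimage]
    rfl
  rw [this]
  exact isClosed_iInter fun i => isClosed_Icc.preimage (by fun_prop)

theorem convex_cube : Convex ℝ (cube n) := by
  intro x hx y hy a b ha hb hab i
  exact convex_Icc (0 : ℝ) 1 (hx i) (hy i) ha hb hab

theorem reflectionCLM_apply (v : Space n) (i : Fin n) :
    reflectionCLM n v i = (if (i : ℕ) + 1 = n then -1 else 1) * v i := by
  rw [reflectionCLM, ← WithLp.toLp_ofLp 2 v, Matrix.toEuclideanCLM_toLp]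
  simp [reflectionMatrix, Matrix.mulVec_diagonal]

theorem reflectLast_sub (x y : Space n) :
    reflectLast x - reflectLast y = reflectionCLM n (x - y) := by
  ext i
  rw [reflectionCLM_apply]
  simp only [reflectLast, PiLp.sub_apply]
  split_ifs <;> ring

theorem hasFDerivAt_reflectLast (x : Space n) :
    HasFDerivAt reflectLast (reflectionCLM n) x := by
  have : (reflectLast : Space n → Space n) = fun y => reflectionCLM n (y - x) + reflectLast x := by
    ext1 y
    rw [← reflectLast_sub, sub_add_cancel]
  rw [this]
  have h : HasFDerivAt (fun y : Space n => y - x) (ContinuousLinearMap.id ℝ (Space n)) x :=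
    (hasFDerivAt_id x).sub_const x
  exact ((reflectionCLM n).hasFDerivAt.comp x h).add_const (reflectLast x)

theorem isDensityPoint_of_mem_interior {T : Set (Space n)} {x : Space n} (hx : x ∈ interior T) :
    IsDensityPoint T x := by
  obtain ⟨ε, hε, hball⟩ := Metric.mem_nhds_iff.1 (mem_interior_iff_mem_nhds.1 hx)
  refine tendsto_const_nhds.congr' ?_
  filter_upwards [Ioo_mem_nhdsGT hε] with ρ hρ
  rw [inter_eq_self_of_subset_right ((Metric.closedBall_subset_ball hρ.2).trans hball),
    ENNReal.div_self (Metric.measure_closedBall_pos volume x hρ.1).ne'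
      measure_closedBall_lt_top.ne]

theorem ae_isDensityPoint {T : Set (Space n)} (hT : MeasurableSet T) :
    ∀ᵐ x ∂(volume.restrict T), IsDensityPoint T x := by
  rw [ae_restrict_iff' hT]
  filter_upwards [Besicovitch.ae_tendsto_measure_inter_div_of_measurableSet volume hT] with x h hx
  rwa [indicator_of_mem hx, Pi.one_apply] at h

open Classical in
/-- The limit of the maps `iter r G k 0`: a point off the Cantor set leaves the sets
`level n r k 0` at some stage, from which on the sequence is constant; on the Cantor set the limit
is the reflection. -/
noncomputable def limitMap (r : ℕ → ℝ) (G : ℕ → Space n → Space n) (x : Space n) : Space n :=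
  if h : ∃ k, x ∉ level n r k 0 then iter r G (Nat.find h) 0 x else reflectLast x

theorem exists_notMem_level {r : ℕ → ℝ} {x : Space n} (hx : x ∉ limitSet n r 0) :
    ∃ k, x ∉ level n r k 0 :=
  not_forall.1 hx

theorem limitMap_of_mem {r : ℕ → ℝ} {G : ℕ → Space n → Space n} {x : Space n}
    (hx : x ∈ limitSet n r 0) : limitMap r G x = reflectLast x :=
  dif_neg fun ⟨k, hk⟩ => hk (hx k)

namespace IsSwapSeq
variable {r L : ℕ → ℝ} {G G' : ℕ → Space n → Space n}

theorem limitMap_of_notMem (h : IsSwapSeq r L G G') {k : ℕ} {x : Space n}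
    (hx : x ∉ level n r k 0) : limitMap r G x = iter r G k 0 x := by
  classical
  have hex : ∃ k, x ∉ level n r k 0 := ⟨k, hx⟩
  rw [limitMap, dif_pos hex]
  have := h.iter_eq_of_le (Nat.find_min' hex hx) (Nat.find_spec hex)
  rw [this]

theorem iter_notMem_level (h : IsSwapSeq r L G G') {k m : ℕ} {x : Space n}
    (hx : x ∉ level n r k m) : iter r G k m x ∉ level n r k m := fun hmem => by
  have := h.symm.mapsTo_iter_level k m hmem
  rw [h.leftInverse_iter k m x] at this
  exact hx this

theorem leftInverse_limitMap (h : IsSwapSeq r L G G') :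
    Function.LeftInverse (limitMap r G') (limitMap r G) := fun x => by
  by_cases hx : x ∈ limitSet n r 0
  · rw [limitMap_of_mem hx, limitMap_of_mem (h.reflectLast_mem_limitSet hx),
      reflectLast_reflectLast]
  · obtain ⟨k, hk⟩ := exists_notMem_level hx
    rw [h.limitMap_of_notMem hk, h.symm.limitMap_of_notMem (h.iter_notMem_level hk),
      h.leftInverse_iter k 0 x]

theorem mapsTo_limitMap_cube (h : IsSwapSeq r L G G') :
    MapsTo (limitMap r G) (cube n) (cube n) := fun x hx => by
  by_cases hA : x ∈ limitSet n r 0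
  · rw [limitMap_of_mem hA]
    exact reflectLast_mem_cube hx
  · obtain ⟨k, hk⟩ := exists_notMem_level hA
    rw [h.limitMap_of_notMem hk]
    exact h.mapsTo_iter_cube k 0 hx

theorem mapsTo_limitMap_compl (h : IsSwapSeq r L G G') :
    MapsTo (limitMap r G) (limitSet n r 0)ᶜ (limitSet n r 0)ᶜ := fun x hx hmem => by
  obtain ⟨k, hk⟩ := exists_notMem_level hx
  rw [h.limitMap_of_notMem hk] at hmem
  exact h.iter_notMem_level hk (hmem k)

theorem norm_limitMap_sub_iter_le (h : IsSwapSeq r L G G') (k : ℕ) (x : Space n) :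
    ‖limitMap r G x - iter r G k 0 x‖ ≤ n * (1 / 2) ^ k := by
  by_cases hk : x ∈ level n r k 0
  · by_cases hx : x ∈ limitSet n r 0
    · rw [limitMap_of_mem hx, norm_sub_rev]
      exact h.norm_iter_sub_reflectLast_le k 0 x hk
    · obtain ⟨j, hj⟩ := exists_notMem_level hx
      rw [h.limitMap_of_notMem hj]
      refine h.norm_iter_sub_iter_le k j 0 x ?_ hk
      by_contra! hlt
      exact hj (h.level_subset_of_le hlt.le 0 hk)
  · rw [h.limitMap_of_notMem hk, sub_self, norm_zero]
    positivity

theorem limitMap_eventuallyEq (h : IsSwapSeq r L G G') {k : ℕ} {x : Space n}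
    (hx : x ∉ level n r k 0) : limitMap r G =ᶠ[𝓝 x] iter r G k 0 := by
  filter_upwards [(h.isClosed_level k 0).isOpen_compl.mem_nhds hx] with y hy
  exact h.limitMap_of_notMem hy

theorem contDiffAt_limitMap (h : IsSwapSeq r L G G') {x : Space n} (hx : x ∉ limitSet n r 0) :
    ContDiffAt ℝ ∞ (limitMap r G) x := by
  obtain ⟨k, hk⟩ := exists_notMem_level hx
  exact (h.contDiff_iter k 0).contDiffAt.congr_of_eventuallyEq (h.limitMap_eventuallyEq hk)

theorem volume_image_limitMap_eq_zero (h : IsSwapSeq r L G G') {N : Set (Space n)}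
    (hN : volume N = 0) : volume (limitMap r G '' N) = 0 := by
  have hsub : limitMap r G '' N ⊆ reflectLast '' N ∪ ⋃ k, iter r G k 0 '' N := by
    rintro _ ⟨x, hx, rfl⟩
    by_cases hA : x ∈ limitSet n r 0
    · rw [limitMap_of_mem hA]
      exact Or.inl (mem_image_of_mem _ hx)
    · obtain ⟨k, hk⟩ := exists_notMem_level hA
      rw [h.limitMap_of_notMem hk]
      exact Or.inr (mem_iUnion.2 ⟨k, mem_image_of_mem _ hx⟩)
  refine measure_mono_null hsub (measure_union_null ?_ (measure_iUnion_null fun k => ?_))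
  · exact addHaar_image_eq_zero_of_differentiableOn_of_addHaar_eq_zero volume
      (fun x _ => (hasFDerivAt_reflectLast x).differentiableAt.differentiableWithinAt) hN
  · exact addHaar_image_eq_zero_of_differentiableOn_of_addHaar_eq_zero volume
      ((h.contDiff_iter k 0).differentiable (by simp)).differentiableOn hN

theorem ae_hasApproxFDerivOnAt_of_mem (h : IsSwapSeq r L G G') :
    ∀ᵐ x ∂(volume.restrict (limitSet n r 0)),
      HasApproxFDerivOnAt (limitMap r G) (reflectionCLM n) (cube n) x := by
  have hm := (h.isClosed_limitSet 0).measurableSet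
  filter_upwards [ae_isDensityPoint hm, ae_restrict_mem hm] with x hx hxA
  exact ⟨limitSet n r 0, limitSet_subset_cube r 0, hm, hx,
    (hasFDerivAt_reflectLast x).hasFDerivWithinAt.congr (fun y hy => limitMap_of_mem hy)
      (limitMap_of_mem hxA)⟩

theorem ae_exists_hasApproxFDerivOnAt (h : IsSwapSeq r L G G') :
    ∀ᵐ x ∂(volume.restrict (cube n)),
      ∃ D, HasApproxFDerivOnAt (limitMap r G) D (cube n) x := by
  have h1 := h.ae_hasApproxFDerivOnAt_of_mem
  rw [ae_restrict_iff' (h.isClosed_limitSet 0).measurableSet] at h1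
  have h2 : ∀ᵐ x : Space n, x ∉ frontier (cube n) :=
    measure_eq_zero_iff_ae_notMem.1 (convex_cube.addHaar_frontier volume)
  rw [ae_restrict_iff' isClosed_cube.measurableSet]
  filter_upwards [h1, h2] with x hx1 hx2 hxQ
  by_cases hA : x ∈ limitSet n r 0
  · exact ⟨_, hx1 hA⟩
  · have hint : x ∈ interior (cube n) := by
      by_contra hni
      exact hx2 ⟨subset_closure hxQ, hni⟩
    exact ⟨_, cube n, Subset.rfl, isClosed_cube.measurableSet, isDensityPoint_of_mem_interior hint,
      ((h.contDiffAt_limitMap hA).differentiableAt (by simp)).hasFDerivAt.hasFDerivWithinAt⟩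

/-- At the distance `t ∈ (d (k + 1), d k]` the limit is compared with the map of generation `k + 1`,
whose Lipschitz constant is of order `φ (d k) / d k ≤ φ t / t`, and from which it differs by at
most a multiple of `2 ^ (-k)`, hence of `φ t`. -/
theorem norm_limitMap_sub_le (h : IsSwapSeq r L G G') {φ : ℝ → ℝ} {d : ℕ → ℝ} {K : ℝ} (hK : 0 ≤ K)
    (hφ_mono : StrictMonoOn φ (Ici 0)) (hφ_concave : ConcaveOn ℝ (Ici 0) φ) (hφ_zero : φ 0 = 0)
    (hd0 : d 0 = 1) (hd : ∀ k, 0 < d k) (hφd : ∀ k, φ (d k) = φ 1 * (1 / 2) ^ k)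
    (hhalf : ∀ k, d (k + 1) ≤ d k / 2) (hL : ∀ k, L k = K / (2 ^ k * d k)) (hL1 : ∀ k, 1 ≤ L k)
    {x y : Space n} (hx : x ∈ cube n) (hy : y ∈ cube n) :
    ‖limitMap r G x - limitMap r G y‖ ≤ (2 * n + K) / φ 1 * φ ‖x - y‖ := by
  have h1 : 0 < φ 1 := by
    rw [← hφ_zero]
    exact hφ_mono (mem_Ici.2 le_rfl) (mem_Ici.2 zero_le_one) one_pos
  rcases (norm_nonneg (x - y)).eq_or_lt with h0 | h0
  · rw [← h0, hφ_zero, mul_zero]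
    rw [sub_eq_zero.1 (norm_eq_zero.1 h0.symm), sub_self, norm_zero]
  set t := ‖x - y‖ with ht
  rcases le_or_gt t 1 with ht1 | ht1
  · obtain ⟨k, hk1, hk2⟩ := exists_mem_Ioc_of_halving hd0 hhalf h0 ht1
    have hLmono : Monotone L := monotone_nat_of_le_succ fun j => by
      rw [hL, hL]
      have := hd j
      have := hd (j + 1)
      refine div_le_div_of_nonneg_left hK (by positivity) ?_
      rw [pow_succ]
      nlinarith [hhalf j, pow_pos (two_pos (α := ℝ)) j]
    have e1 := h.norm_limitMap_sub_iter_le (k + 1) x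
    have e2 := h.norm_limitMap_sub_iter_le (k + 1) y
    have e3 := h.norm_iter_sub_le (hL1 k) (k + 1) 0
      (fun j hj => hLmono (by omega : 0 + j ≤ k)) (fun j => zero_le_one.trans (hL1 j)) x y
    have e4 : φ 1 * (1 / 2) ^ (k + 1) ≤ φ t := by
      rw [← hφd]
      exact hφ_mono.monotoneOn (hd _).le h0.le hk1.le
    have e5 : L k * t ≤ K / φ 1 * φ t := by
      have := mul_le_mul_of_concaveOn hφ_concave hφ_zero h0.le hk2
      rw [hφd] at this
      have hdk := hd k
      rw [hL, div_mul_eq_mul_div, div_le_iff₀ (by positivity)]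
      have e : K / φ 1 * φ t * (2 ^ k * d k) = K / φ 1 * 2 ^ k * (d k * φ t) := by ring
      rw [e]
      calc K * t = K / φ 1 * 2 ^ k * (t * (φ 1 * (1 / 2) ^ k)) := by
            rw [one_div_pow]; field_simp
        _ ≤ _ := mul_le_mul_of_nonneg_left this (by positivity)
    have e6 : (n : ℝ) * (1 / 2) ^ (k + 1) ≤ n / φ 1 * φ t := by
      calc (n : ℝ) * (1 / 2) ^ (k + 1) = n / φ 1 * (φ 1 * (1 / 2) ^ (k + 1)) := by field_simp
        _ ≤ _ := mul_le_mul_of_nonneg_left e4 (by positivity)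
    have e7 : limitMap r G x - limitMap r G y = (limitMap r G x - iter r G (k + 1) 0 x) +
        ((iter r G (k + 1) 0 x - iter r G (k + 1) 0 y) -
          (limitMap r G y - iter r G (k + 1) 0 y)) := by abel
    rw [e7]
    have e8 := norm_add_le (limitMap r G x - iter r G (k + 1) 0 x)
      ((iter r G (k + 1) 0 x - iter r G (k + 1) 0 y) - (limitMap r G y - iter r G (k + 1) 0 y))
    have e9 := norm_sub_le (iter r G (k + 1) 0 x - iter r G (k + 1) 0 y)
      (limitMap r G y - iter r G (k + 1) 0 y)
    have e10 : (2 * n + K) / φ 1 * φ t = n / φ 1 * φ t + (K / φ 1 * φ t + n / φ 1 * φ t) := by ring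
    linarith
  · have e1 := norm_sub_le_of_mem_cube (h.mapsTo_limitMap_cube hx) (h.mapsTo_limitMap_cube hy)
    have e2 : φ 1 ≤ φ t := hφ_mono.monotoneOn (mem_Ici.2 zero_le_one) h0.le ht1.le
    refine e1.trans ?_
    rw [div_mul_eq_mul_div, le_div_iff₀ h1]
    have : (0 : ℝ) ≤ n := Nat.cast_nonneg n
    nlinarith

theorem limitMap_eq_self_of_mem_frontier (h : IsSwapSeq r L G G') {x : Space n}
    (hx : x ∈ frontier (cube n)) : limitMap r G x = x := by
  have hA : x ∉ limitSet n r 0 := fun hA => hx.2 (h.limitSet_subset_interior 0 hA)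
  obtain ⟨k, hk⟩ := exists_notMem_level hA
  rw [h.limitMap_of_notMem hk]
  have heq : EqOn (iter r G k 0) id (cube n)ᶜ := fun y hy => h.iter_eq_self k 0 y hy
  rw [frontier_eq_closure_inter_closure] at hx
  exact heq.closure (h.contDiff_iter k 0).continuous continuous_id hx.2

end IsSwapSeq

theorem continuousOn_of_norm_sub_le {f : Space n → Space n} {S : Set (Space n)} {φ : ℝ → ℝ} {C : ℝ}
    (hφ_cont : ContinuousOn φ (Ici 0)) (hφ_zero : φ 0 = 0)
    (hf : ∀ x ∈ S, ∀ y ∈ S, ‖f x - f y‖ ≤ C * φ ‖x - y‖) : ContinuousOn f S := by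
  intro x hx
  rw [ContinuousWithinAt, tendsto_iff_norm_sub_tendsto_zero]
  have h1 : Tendsto (fun y : Space n => ‖y - x‖) (𝓝[S] x) (𝓝[Ici 0] 0) := by
    refine tendsto_nhdsWithin_iff.2 ⟨?_, Eventually.of_forall fun y => norm_nonneg _⟩
    have : Tendsto (fun y : Space n => ‖y - x‖) (𝓝 x) (𝓝 ‖x - x‖) :=
      Continuous.tendsto (by fun_prop) x
    rw [sub_self, norm_zero] at this
    exact this.mono_left nhdsWithin_le_nhds
  have h2 : Tendsto φ (𝓝[Ici 0] 0) (𝓝 0) := by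
    simpa only [ContinuousWithinAt, hφ_zero] using hφ_cont 0 (mem_Ici.2 le_rfl)
  have h3 := (h2.comp h1).const_mul C
  rw [mul_zero] at h3
  refine squeeze_zero' (Eventually.of_forall fun y => norm_nonneg _) ?_ h3
  filter_upwards [self_mem_nhdsWithin] with y hy
  exact hf y hy x hx


end CubeFlip

open CubeFlip in
theorem proposition1p3 (n : ℕ) (hn : 2 ≤ n) (φ : ℝ → ℝ)
    (hφ_mono : StrictMonoOn φ (Ici 0)) (hφ_concave : ConcaveOn ℝ (Ici 0) φ)
    (hφ_cont : ContinuousOn φ (Ici 0)) (hφ_zero : φ 0 = 0)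
    (hφ_int : IntegrableOn (fun s : ℝ => 1 / φ s) (Ioc 0 1)) :
    ∃ (Φ : PartialEquiv (CubeFlip.Space n) (CubeFlip.Space n)) (A : Set (CubeFlip.Space n)) (C : ℝ),
      CubeFlip.IsSelfHomeo Φ (CubeFlip.cube n) ∧
      (∀ᵐ x ∂(volume.restrict (CubeFlip.cube n)),
        ∃ L, CubeFlip.HasApproxFDerivOnAt Φ L (CubeFlip.cube n) x) ∧
      CubeFlip.LusinN Φ (CubeFlip.cube n) ∧
      CubeFlip.IsCantorSet A ∧
      A ⊆ interior (CubeFlip.cube n) ∧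
      (∀ x ∈ frontier (CubeFlip.cube n), Φ x = x) ∧
      0 < volume A ∧
      (∀ x ∈ A, Φ x = CubeFlip.reflectLast x) ∧
      Φ '' A = A ∧
      CubeFlip.IsSmoothDiffeoOn Φ (CubeFlip.cube n \ A) ∧
      (∀ᵐ x ∂(volume.restrict A),
        CubeFlip.HasApproxFDerivOnAt Φ (CubeFlip.reflectionCLM n) (CubeFlip.cube n) x) ∧
      (∀ x ∈ CubeFlip.cube n, ∀ y ∈ CubeFlip.cube n,
        ‖Φ x - Φ y‖ + ‖Φ.symm x - Φ.symm y‖ ≤ C * φ ‖x - y‖) := by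
  obtain ⟨d, hd0, hd, hφd, hhalf, hsum⟩ :=
    exists_gaps hφ_mono hφ_concave hφ_cont hφ_zero hφ_int
  obtain ⟨L, hL1, hswap⟩ := exists_isSwap hn
  set S := ∑' k, (2 : ℝ) ^ k * d k with hS
  have hpos : ∀ k, 0 < (2 : ℝ) ^ k * d k := fun k => mul_pos (by positivity) (hd k)
  have hle : ∀ k, (2 : ℝ) ^ k * d k ≤ S := fun k => hsum.le_tsum k fun j _ => (hpos j).le
  have hSpos : 0 < S := (hpos 0).trans_le (hle 0)
  -- The relative gaps `2 ^ k * d k` are scaled so that their sum is `1 / 2`; this makes the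
  -- one-dimensional Cantor set of measure at least `1 / 2`.
  set δ : ℕ → ℝ := fun k => 2 ^ k * d k / (2 * S) with hδ
  have hδpos : ∀ k, 0 < δ k := fun k => div_pos (hpos k) (by positivity)
  have hδle : ∀ k, δ k < 1 := fun k => by
    rw [hδ]
    simp only
    rw [div_lt_one (by positivity)]
    linarith [hle k]
  choose G G' hG hG' hl hr using fun k => hswap (δ k) (hδpos k) (hδle k)
  have h : IsSwapSeq (fun k => (1 - δ k) / 2) (fun k => L / δ k) G G' :=
    ⟨fun m => by linarith [hδle m], fun m => by linarith [hδpos m], hG, hG', hl, hr⟩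
  have hgap : ∀ k, ∑ j ∈ Finset.range k, (1 - 2 * ((1 - δ j) / 2)) ≤ 1 / 2 := fun k => by
    have e : ∀ j, 1 - 2 * ((1 - δ j) / 2) = 2 ^ j * d j / (2 * S) := fun j => by
      rw [mul_div_cancel₀ _ two_ne_zero, sub_sub_cancel]
    simp only [e]
    rw [← Finset.sum_div, div_le_iff₀ (by positivity)]
    have := hsum.sum_le_tsum (Finset.range k) fun j _ => (hpos j).le
    linarith
  set K := L * (2 * S) with hK
  have hK0 : 0 ≤ K := by positivity
  have hLK : ∀ k, L / δ k = K / (2 ^ k * d k) := fun k => by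
    rw [hδ, hK]
    simp only
    rw [div_div_eq_mul_div]
  have hLδ : ∀ k, 1 ≤ L / δ k := fun k => by
    rw [one_le_div (hδpos k)]
    exact (hδle k).le.trans hL1
  set r : ℕ → ℝ := fun k => (1 - δ k) / 2 with hr_def
  have hmod : ∀ {G G' : ℕ → Space n → Space n}, IsSwapSeq r (fun k => L / δ k) G G' →
      ∀ x ∈ cube n, ∀ y ∈ cube n,
        ‖limitMap r G x - limitMap r G y‖ ≤ (2 * n + K) / φ 1 * φ ‖x - y‖ :=
    fun h x hx y hy => h.norm_limitMap_sub_le hK0 hφ_mono hφ_concave hφ_zero hd0 hd hφd hhalf hLK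
      hLδ hx hy
  refine ⟨⟨limitMap r G, limitMap r G', cube n, cube n, fun x hx => h.mapsTo_limitMap_cube hx,
    fun x hx => h.symm.mapsTo_limitMap_cube hx, fun x _ => h.leftInverse_limitMap x,
    fun x _ => h.symm.leftInverse_limitMap x⟩, limitSet n r 0, 2 * ((2 * n + K) / φ 1),
    ⟨rfl, rfl, continuousOn_of_norm_sub_le hφ_cont hφ_zero (hmod h),
      continuousOn_of_norm_sub_le hφ_cont hφ_zero (hmod h.symm)⟩,
    h.ae_exists_hasApproxFDerivOnAt, fun N _ hN => h.volume_image_limitMap_eq_zero hN,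
    h.isCantorSet_limitSet (by omega) hgap, h.limitSet_subset_interior 0,
    fun x hx => h.limitMap_eq_self_of_mem_frontier hx, h.volume_limitSet_pos hgap,
    fun x hx => limitMap_of_mem hx, ?_, ⟨sdiff_subset, ?_, ?_⟩,
    h.ae_hasApproxFDerivOnAt_of_mem, fun x hx y hy => ?_⟩
  · ext x
    constructor
    · rintro ⟨y, hy, rfl⟩
      change limitMap r G y ∈ limitSet n r 0
      rw [limitMap_of_mem hy]
      exact h.reflectLast_mem_limitSet hy
    · intro hx
      refine ⟨reflectLast x, h.reflectLast_mem_limitSet hx, ?_⟩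
      exact (limitMap_of_mem (h.reflectLast_mem_limitSet hx)).trans (reflectLast_reflectLast x)
  · exact fun x hx => (h.contDiffAt_limitMap hx.2).contDiffWithinAt
  · rintro _ ⟨x, hx, rfl⟩
    exact (h.symm.contDiffAt_limitMap (h.mapsTo_limitMap_compl hx.2)).contDiffWithinAt
  · have h1 := hmod h x hx y hy
    have h2 := hmod h.symm x hx y hy
    change ‖limitMap r G x - limitMap r G y‖ + ‖limitMap r G' x - limitMap r G' y‖ ≤ _
    linarith
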